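/- Let $(M,\omega)$ be a (finite-dimensional, Hausdorff, second countable, smooth) symplectic manifold without boundary and let $X\subseteq M$ be a closed subset. For a smooth time-dependent vector field $V$ on $M$ ($t\in[0,1]$), let $\mathcal D_V^t$ be the set of $x_0\in M$ for which $\dot x(s)=V(s,x(s))$, $x(0)=x_0$, has a solution $x\in C^\infty([0,t],M)$, and let $\phi_V^t:\mathcal D_V^t\to M$, $\phi_V^t(x_0)=x(t)$, be the time-$t$ flow. Call $V$ $X$-compatible if $X\subseteq\mathcal D_V^1$ and $\phi_V^t(X)=X$ for every $t\in[0,1]$. For $H\in C^\infty([0,1]\times M,\mathbb R)$ let $X_H$ be its Hamiltonian vector field, $\omega(X_{H}(t,x),\cdot)=d(H(t,\cdot))(x)$, and put $\phi_H^t:=\phi_{X_H}^t$. Define $$\mathcal H(M,\omega,X):=\{H\in C^\infty([0,1]\times M,\mathbb R)\mid X_H\text{ is }X\text{-compatible}\},$$ $$\mathrm{Ham}(X,\omega):=\mathrm{Ham}(X,M,\omega):=\{\phi_H^1|_X:X\to X\mid H\in\mathcal H(M,\omega,X)\}.$$ Then: (i) $\mathrm{Ham}(X,\omega)$ is a subgroup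 of the group of homeomorphisms of $X$ (in particular each of its elements is a homeomorphism of $X$). (ii) If $X$ is a symplectic submanifold of $M$ (an embedded submanifold such that $\omega|_X$ is nondegenerate), then $$\mathrm{Ham}(X,\omega)=\mathrm{Ham}(X,\omega|_X),$$ where the right-hand side is $\mathrm{Ham}(X,X,\omega|_X)$, i.e. $X$ is regarded as a subset of the symplectic manifold $(X,\omega|_X)$. -/

import Mathlib

open Set Topology Manifold ContDiff Bundle

noncomputable section

/-- A (not necessarily continuous) field of bilinear forms on the tangent spaces of `M`. -/
abbrev TangentBilin (E : Type*) [NormedAddCommGroup E] [NormedSpace ℝ E]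
    (M : Type*) [TopologicalSpace M] [ChartedSpace E M] : Type _ :=
  ∀ x : M, TangentSpace 𝓘(ℝ, E) x →L[ℝ] TangentSpace 𝓘(ℝ, E) x →L[ℝ] ℝ

section

variable {E : Type*} [NormedAddCommGroup E] [NormedSpace ℝ E]
  {M : Type*} [TopologicalSpace M] [ChartedSpace E M]
  {F : Type*} [NormedAddCommGroup F] [NormedSpace ℝ F]
  {N : Type*} [TopologicalSpace N] [ChartedSpace F N]

/-- The pullback `(f^* om)_x (u, v) = om_{f x} (df_x u, df_x v)`. -/
def pullbackBilin (f : N → M) (om : TangentBilin E M) : TangentBilin F N := fun x =>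
  ((ContinuousLinearMap.precomp ℝ (mfderiv 𝓘(ℝ, F) 𝓘(ℝ, E) f x)).comp (om (f x))).comp
    (mfderiv 𝓘(ℝ, F) 𝓘(ℝ, E) f x)

/-- Pointwise nondegeneracy. -/
def IsNondegenerateForm (om : TangentBilin E M) : Prop :=
  ∀ (x : M) (v : TangentSpace 𝓘(ℝ, E) x), (∀ w, om x v w = 0) → v = 0

/-- The coordinate expression of `om` in the preferred chart at `x₀`: its pullback under the
inverse of that chart. It is meaningful on the target of the chart. -/
def coordForm (om : TangentBilin E M) (x₀ : M) : E → E →L[ℝ] E →L[ℝ] ℝ :=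
  fun y => pullbackBilin (N := E) (extChartAt 𝓘(ℝ, E) x₀).symm om y

/-- `dom = 0`, expressed in charts:
`dom (u, v, w) = (D_u om) (v, w) - (D_v om) (u, w) + (D_w om) (u, v)`. -/
def IsClosedForm (om : TangentBilin E M) : Prop :=
  ∀ (x₀ : M), ∀ y ∈ (extChartAt 𝓘(ℝ, E) x₀).target, ∀ u v w : E,
    fderiv ℝ (coordForm om x₀) y u v w - fderiv ℝ (coordForm om x₀) y v u w
      + fderiv ℝ (coordForm om x₀) y w u v = 0

/-- `om` is a symplectic form on `M`: a smooth closed nondegenerate differential two-form. -/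
structure IsSymplecticForm [IsManifold 𝓘(ℝ, E) ∞ M] (om : TangentBilin E M) : Prop where
  smooth : ContMDiff 𝓘(ℝ, E) (𝓘(ℝ, E).prod 𝓘(ℝ, E →L[ℝ] E →L[ℝ] ℝ)) ∞
    (fun x => TotalSpace.mk' (E →L[ℝ] E →L[ℝ] ℝ)
      (E := fun x : M => TangentSpace 𝓘(ℝ, E) x →L[ℝ] TangentSpace 𝓘(ℝ, E) x →L[ℝ] ℝ) x (om x))
  alternating : ∀ (x : M) (v : TangentSpace 𝓘(ℝ, E) x), om x v v = 0
  nondegenerate : IsNondegenerateForm om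
  closed : IsClosedForm om

/-- `γ : [0, t] → M` is a smooth solution of `γ' (s) = V (s, γ s)`, `γ 0 = x₀`.
Only the values of `γ` on `[0, t]` matter. -/
structure IsFlowLine (V : ℝ → ∀ x : M, TangentSpace 𝓘(ℝ, E) x) (t : ℝ) (x₀ : M)
    (γ : ℝ → M) : Prop where
  smooth : ContMDiffOn 𝓘(ℝ, ℝ) 𝓘(ℝ, E) ∞ γ (Icc 0 t)
  initial : γ 0 = x₀
  equation : ∀ s ∈ Icc (0 : ℝ) t, HasMFDerivWithinAt 𝓘(ℝ, ℝ) 𝓘(ℝ, E) γ (Icc 0 t) s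
    ((1 : ℝ →L[ℝ] ℝ).smulRight (V s (γ s)))

/-- The domain of the time-`t` flow of a time-dependent vector field. -/
def flowDomain (V : ℝ → ∀ x : M, TangentSpace 𝓘(ℝ, E) x) (t : ℝ) : Set M :=
  {x₀ | ∃ γ : ℝ → M, IsFlowLine V t x₀ γ}

open Classical in
/-- The time-`t` flow: the endpoint at time `t` of the solution starting at `x₀`.
Off its domain it has the irrelevant value `x₀`. -/
def flow (V : ℝ → ∀ x : M, TangentSpace 𝓘(ℝ, E) x) (t : ℝ) (x₀ : M) : M :=
  if h : ∃ γ : ℝ → M, IsFlowLine V t x₀ γ then h.choose t else x₀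

/-- `V` is `X`-compatible. -/
def IsCompatible (X : Set M) (V : ℝ → ∀ x : M, TangentSpace 𝓘(ℝ, E) x) : Prop :=
  X ⊆ flowDomain V 1 ∧ ∀ t ∈ Icc (0 : ℝ) 1, flow V t '' X = X

/-- The time-dependent Hamiltonian vector field: the value at `(t, x)` is the vector `v` with
`om_x (v, ·) = d(H_t)_x` (it exists and is unique if `M` is finite-dimensional and `om` is
nondegenerate). -/
def hamVectorField (om : TangentBilin E M) (H : ℝ → M → ℝ) (t : ℝ) (x : M) :
    TangentSpace 𝓘(ℝ, E) x :=
  Classical.epsilon fun v => ∀ w, om x v w = mfderiv 𝓘(ℝ, E) 𝓘(ℝ, ℝ) (H t) x w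

/-- The smooth functions `H` on `[0, 1] × M` whose Hamiltonian vector field is `X`-compatible.
Only the values of `H` at times in `[0, 1]` matter. -/
def compatibleHamiltonians (om : TangentBilin E M) (X : Set M) : Set (ℝ → M → ℝ) :=
  {H | ContMDiffOn (𝓘(ℝ, ℝ).prod 𝓘(ℝ, E)) 𝓘(ℝ, ℝ) ∞ (fun p : ℝ × M => H p.1 p.2)
      (Icc 0 1 ×ˢ univ) ∧ IsCompatible X (hamVectorField om H)}

/-- `Ham(X, om)`: the restrictions to `X`, as maps from `X` to `X`, of the time-one flows of
the functions in `compatibleHamiltonians om X`. -/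
def Ham (om : TangentBilin E M) (X : Set M) : Set (X → X) :=
  {φ | ∃ H ∈ compatibleHamiltonians om X, ∀ x : X, (φ x : M) = flow (hamVectorField om H) 1 x}

variable (F) in
/-- The subset `X`, with the subspace topology and the given smooth structure modelled on `F`,
is an (embedded) symplectic submanifold of `(M, om)`. -/
structure IsSymplecticSubmanifold (om : TangentBilin E M) (X : Set M) [ChartedSpace F X]
    [IsManifold 𝓘(ℝ, F) ∞ X] : Prop where
  embedding : IsSmoothEmbedding 𝓘(ℝ, F) 𝓘(ℝ, E) ∞ (Subtype.val : X → M)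
  nondegenerate : IsNondegenerateForm (pullbackBilin (F := F) (Subtype.val : X → M) om)

end

end

/-! Part (i). On `X` the flow is continuous, by short-time Picard–Lindelöf flows in charts and a
supremum argument in time. The constant Hamiltonian `0` gives the identity. If `H` has flow `φ^t`,
then `-H (1 - t)` runs the flow lines of `H` backwards, so on `X` its flow is `φ^(1-t) ∘ (φ^1)⁻¹`.
For a product, two Hamiltonians are run one after the other, each slowed down by a smooth time
change that becomes stationary, so that the concatenated curves stay smooth. All intermediate flows
map `X` onto `X`, so compatibility survives. These are `exists_reverse_mem_compatibleHamiltonians`,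
`exists_concatenation_mem_compatibleHamiltonians` and `IsCompatible.continuousOn_flow`.

Part (ii), restriction. If `φ^t(X) = X` for all `t`, every point of `X` is at every time passed by a
flow line that stays in `X`. Such a line is smooth as a curve in `X`, because an embedded
submanifold is locally a smooth retract, so `X_H` is tangent to `X` along `X`. Testing `om (X_H, ·)
= dH` on vectors tangent to `X` identifies `X_H` there with the Hamiltonian vector field of `H|_X`
(`IsSymplecticSubmanifold.restrictsTo_of_isCompatible`).

Part (ii), extension. Given `h` on `X`, an extension `H` is needed whose differential at `y ∈ X` is
the full covector `om (X_h, ·)`, not just its restriction to `T_y X`. On `T_y X` this covector is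
`dh`, so value and differential are consistent and a local extension exists to first order
(`exists_local_extension`). A partition of unity glues the local extensions: they share their values
on `X`, so the derivatives of the cutoffs cancel. Nondegeneracy then forces `X_H = X_h` along `X`,
and uniqueness of solutions identifies the flows. -/

noncomputable section

/-! ### Vector fields and forms in charts -/

section ChartDerivatives

variable {E : Type*} [NormedAddCommGroup E] [NormedSpace ℝ E]
  {M : Type*} [TopologicalSpace M] [ChartedSpace E M]

/-- The derivative at `x` of the preferred chart at `x₀`. -/
def chartDeriv (x₀ x : M) : TangentSpace 𝓘(ℝ, E) x →L[ℝ] E :=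
  mfderiv 𝓘(ℝ, E) 𝓘(ℝ, E) (extChartAt 𝓘(ℝ, E) x₀) x

/-- The derivative at `y` of the inverse of the preferred chart at `x₀`. -/
def chartSymmDeriv (x₀ : M) (y : E) :
    E →L[ℝ] TangentSpace 𝓘(ℝ, E) ((extChartAt 𝓘(ℝ, E) x₀).symm y) :=
  mfderiv 𝓘(ℝ, E) 𝓘(ℝ, E) (extChartAt 𝓘(ℝ, E) x₀).symm y

/-- The coordinate expression of a time-dependent vector field in the preferred chart at `x₀`. -/
def coordField (V : ℝ → ∀ x : M, TangentSpace 𝓘(ℝ, E) x) (x₀ : M) (t : ℝ) (y : E) : E :=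
  chartDeriv x₀ ((extChartAt 𝓘(ℝ, E) x₀).symm y) (V t ((extChartAt 𝓘(ℝ, E) x₀).symm y))

theorem coordField_extChartAt (V : ℝ → ∀ x : M, TangentSpace 𝓘(ℝ, E) x) {x₀ x : M}
    (hx : x ∈ (extChartAt 𝓘(ℝ, E) x₀).source) (t : ℝ) :
    coordField V x₀ t (extChartAt 𝓘(ℝ, E) x₀ x) = chartDeriv x₀ x (V t x) := by
  unfold coordField
  rw [(extChartAt 𝓘(ℝ, E) x₀).left_inv hx]

theorem coordForm_apply (om : TangentBilin E M) (x₀ : M) (y u w : E) :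
    coordForm om x₀ y u w =
      om ((extChartAt 𝓘(ℝ, E) x₀).symm y) (chartSymmDeriv x₀ y u) (chartSymmDeriv x₀ y w) :=
  rfl

variable [IsManifold 𝓘(ℝ, E) ∞ M]

theorem hasMFDerivAt_extChartAt_symm {x₀ : M} {y : E}
    (hy : y ∈ (extChartAt 𝓘(ℝ, E) x₀).target) :
    HasMFDerivAt 𝓘(ℝ, E) 𝓘(ℝ, E) (extChartAt 𝓘(ℝ, E) x₀).symm y (chartSymmDeriv x₀ y) := by
  have := mdifferentiableWithinAt_extChartAt_symm (I := 𝓘(ℝ, E)) hy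
  rw [ModelWithCorners.range_eq_univ, mdifferentiableWithinAt_univ] at this
  exact this.hasMFDerivAt

theorem hasMFDerivAt_extChartAt_of_mem {x₀ x : M}
    (hx : x ∈ (extChartAt 𝓘(ℝ, E) x₀).source) :
    HasMFDerivAt 𝓘(ℝ, E) 𝓘(ℝ, E) (extChartAt 𝓘(ℝ, E) x₀) x (chartDeriv x₀ x) :=
  (mdifferentiableAt_extChartAt (by rwa [extChartAt_source] at hx)).hasMFDerivAt

theorem chartDeriv_chartSymmDeriv {x₀ : M} {y : E}
    (hy : y ∈ (extChartAt 𝓘(ℝ, E) x₀).target) (u : E) :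
    chartDeriv x₀ ((extChartAt 𝓘(ℝ, E) x₀).symm y) (chartSymmDeriv x₀ y u) = u := by
  have := mfderiv_extChartAt_comp_mfderivWithin_extChartAt_symm (I := 𝓘(ℝ, E)) hy
  rw [ModelWithCorners.range_eq_univ, mfderivWithin_univ] at this
  exact DFunLike.congr_fun this u

theorem chartSymmDeriv_chartDeriv {x₀ : M} {y : E}
    (hy : y ∈ (extChartAt 𝓘(ℝ, E) x₀).target)
    (v : TangentSpace 𝓘(ℝ, E) ((extChartAt 𝓘(ℝ, E) x₀).symm y)) :
    chartSymmDeriv x₀ y (chartDeriv x₀ ((extChartAt 𝓘(ℝ, E) x₀).symm y) v) = v := by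
  have := mfderivWithin_extChartAt_symm_comp_mfderiv_extChartAt (I := 𝓘(ℝ, E)) hy
  rw [ModelWithCorners.range_eq_univ, mfderivWithin_univ] at this
  exact DFunLike.congr_fun this v

theorem chartSymmDeriv_coordField (V : ℝ → ∀ x : M, TangentSpace 𝓘(ℝ, E) x) {x₀ : M} {y : E}
    (hy : y ∈ (extChartAt 𝓘(ℝ, E) x₀).target) (t : ℝ) :
    chartSymmDeriv x₀ y (coordField V x₀ t y) = V t ((extChartAt 𝓘(ℝ, E) x₀).symm y) :=
  chartSymmDeriv_chartDeriv hy _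

theorem HasMFDerivWithinAt.hasDerivWithinAt_extChartAt {γ : ℝ → M} {S : Set ℝ} {s : ℝ}
    {V : ℝ → ∀ x : M, TangentSpace 𝓘(ℝ, E) x} {x₀ : M}
    (h : HasMFDerivWithinAt 𝓘(ℝ, ℝ) 𝓘(ℝ, E) γ S s ((1 : ℝ →L[ℝ] ℝ).smulRight (V s (γ s))))
    (hs : γ s ∈ (extChartAt 𝓘(ℝ, E) x₀).source) :
    HasDerivWithinAt (fun τ => extChartAt 𝓘(ℝ, E) x₀ (γ τ))
      (coordField V x₀ s (extChartAt 𝓘(ℝ, E) x₀ (γ s))) S s := by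
  have h1 := (hasMFDerivAt_extChartAt_of_mem hs).comp_hasMFDerivWithinAt s h
  have h2 : HasFDerivWithinAt (fun τ => extChartAt 𝓘(ℝ, E) x₀ (γ τ))
      ((1 : ℝ →L[ℝ] ℝ).smulRight (chartDeriv x₀ (γ s) (V s (γ s)))) S s := by
    refine HasMFDerivWithinAt.hasFDerivWithinAt (h1.congr_mfderiv ?_)
    ext
    change chartDeriv x₀ (γ s) ((1 : ℝ) • (V s (γ s))) = (1 : ℝ) • _
    rw [map_smul]
  rw [coordField_extChartAt V hs]
  simpa using h2.hasDerivWithinAt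

theorem HasDerivWithinAt.hasMFDerivWithinAt_extChartAt_symm {β : ℝ → E} {S : Set ℝ} {s : ℝ}
    {V : ℝ → ∀ x : M, TangentSpace 𝓘(ℝ, E) x} {x₀ : M}
    (h : HasDerivWithinAt β (coordField V x₀ s (β s)) S s)
    (hs : β s ∈ (extChartAt 𝓘(ℝ, E) x₀).target) :
    HasMFDerivWithinAt 𝓘(ℝ, ℝ) 𝓘(ℝ, E) (fun τ => (extChartAt 𝓘(ℝ, E) x₀).symm (β τ)) S s
      ((1 : ℝ →L[ℝ] ℝ).smulRight (V s ((extChartAt 𝓘(ℝ, E) x₀).symm (β s)))) := by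
  have h1 := (hasMFDerivAt_extChartAt_symm hs).comp_hasMFDerivWithinAt s
    h.hasFDerivWithinAt.hasMFDerivWithinAt
  refine h1.congr_mfderiv ?_
  rw [← chartSymmDeriv_coordField V hs]
  ext
  change chartSymmDeriv x₀ (β s) ((1 : ℝ) • _) = (1 : ℝ) • _
  rw [map_smul]

end ChartDerivatives

/-! ### Uniqueness and continuous dependence for time-dependent vector fields -/

section

open Metric Function ODE
open scoped NNReal

/-- Local solutions of an ordinary differential equation depend in a Lipschitz way on the initial
value and stay in the ball on which the vector field is controlled. -/
theorem IsPicardLindelof.exists_flow_mem_closedBall {E : Type*} [NormedAddCommGroup E]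
    [NormedSpace ℝ E] [CompleteSpace E] {f : ℝ → E → E} {tmin tmax : ℝ} {t₀ : Icc tmin tmax}
    {x₀ : E} {a r L K : ℝ≥0} (hf : IsPicardLindelof f t₀ x₀ a r L K) :
    ∃ α : E → ℝ → E, (∀ x ∈ closedBall x₀ r, α x t₀ = x ∧ (∀ t, α x t ∈ closedBall x₀ a) ∧
      ∀ t ∈ Icc tmin tmax, HasDerivWithinAt (α x) (f t (α x t)) (Icc tmin tmax) t) ∧
      ∃ L' : ℝ≥0, ∀ t ∈ Icc tmin tmax, LipschitzOnWith L' (α · t) (closedBall x₀ r) := by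
  classical
  have (x) (hx : x ∈ closedBall x₀ r) := FunSpace.exists_isFixedPt_next hf hx
  choose α hα using this
  set α' := fun (x : E) ↦ if hx : x ∈ closedBall x₀ r then α x hx |>.compProj else 0 with hα'
  refine ⟨α', fun x hx ↦ ⟨?_, fun t ↦ ?_, fun t ht ↦ ?_⟩, ?_⟩
  · rw [hα']
    beta_reduce
    rw [dif_pos hx, FunSpace.compProj_val, ← hα, FunSpace.next_apply₀]
  · rw [hα']
    beta_reduce
    rw [dif_pos hx]
    exact (α x hx).compProj_mem_closedBall hf.mul_max_le
  · rw [hα']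
    beta_reduce
    rw [dif_pos hx, FunSpace.compProj_apply]
    apply hasDerivWithinAt_picard_Icc t₀.2 hf.continuousOn_uncurry
      (α x hx |>.continuous_compProj.continuousOn)
      (fun _ ht' ↦ α x hx |>.compProj_mem_closedBall hf.mul_max_le)
      x ht |>.congr_of_mem _ ht
    intro t' ht'
    nth_rw 1 [← hα]
    rw [FunSpace.compProj_of_mem ht', FunSpace.next_apply]
  · obtain ⟨L', h⟩ := FunSpace.exists_forall_closedBall_funSpace_dist_le_mul hf
    refine ⟨L', fun t ht ↦ LipschitzOnWith.of_dist_le_mul fun x hx y hy ↦ ?_⟩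
    simp_rw [hα']
    rw [dif_pos hx, dif_pos hy, FunSpace.compProj_apply, FunSpace.compProj_apply,
      ← FunSpace.toContinuousMap_apply_eq_apply, ← FunSpace.toContinuousMap_apply_eq_apply]
    have : Nonempty (Icc tmin tmax) := ⟨t₀⟩
    apply ContinuousMap.dist_le_iff_of_nonempty.mp
    exact h x y hx hy (α x hx) (α y hy) (hα x hx) (hα y hy)

variable {E : Type*} [NormedAddCommGroup E] [NormedSpace ℝ E]
  {M : Type*} [TopologicalSpace M] [ChartedSpace E M]
  {V : ℝ → ∀ x : M, TangentSpace 𝓘(ℝ, E) x}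

/-- In every preferred chart, `V` is continuously differentiable in time and space, for times
in `[0, 1]`. -/
def IsC1Field (V : ℝ → ∀ x : M, TangentSpace 𝓘(ℝ, E) x) : Prop :=
  ∀ x₀ : M, ContDiffOn ℝ 1 (fun p : ℝ × E => coordField V x₀ p.1 p.2)
    (Icc 0 1 ×ˢ (extChartAt 𝓘(ℝ, E) x₀).target)

/-- `γ` solves the differential equation of `V` on `S`. -/
def IsSolutionOn (V : ℝ → ∀ x : M, TangentSpace 𝓘(ℝ, E) x) (γ : ℝ → M) (S : Set ℝ) : Prop :=
  ∀ s ∈ S, HasMFDerivWithinAt 𝓘(ℝ, ℝ) 𝓘(ℝ, E) γ S s ((1 : ℝ →L[ℝ] ℝ).smulRight (V s (γ s)))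

theorem IsSolutionOn.mono {γ : ℝ → M} {S T : Set ℝ} (h : IsSolutionOn V γ T) (hST : S ⊆ T) :
    IsSolutionOn V γ S :=
  fun s hs => (h s (hST hs)).mono hST

theorem IsSolutionOn.continuousOn {γ : ℝ → M} {S : Set ℝ} (h : IsSolutionOn V γ S) :
    ContinuousOn γ S :=
  fun s hs => (h s hs).continuousWithinAt

/-- A `C^1` map on a convex set is locally Lipschitz. Applied jointly in time and space and then
restricted to time slices, this gives constants uniform in time, including at the end times `0` and
`1`. -/
theorem IsC1Field.exists_lipschitzOnWith (hV : IsC1Field V) (x₀ : M) {s₀ : ℝ}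
    (hs₀ : s₀ ∈ Icc (0 : ℝ) 1) {y : E} (hy : y ∈ (extChartAt 𝓘(ℝ, E) x₀).target) :
    ∃ δ > 0, ball y δ ⊆ (extChartAt 𝓘(ℝ, E) x₀).target ∧ ∃ K L : ℝ≥0,
      ∀ s ∈ Icc (0 : ℝ) 1, dist s s₀ < δ → LipschitzOnWith K (coordField V x₀ s) (ball y δ) ∧
        ∀ z ∈ ball y δ, ‖coordField V x₀ s z‖ ≤ L := by
  obtain ⟨ρ, hρ, hρt⟩ := Metric.isOpen_iff.1 (isOpen_extChartAt_target (I := 𝓘(ℝ, E)) x₀) y hy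
  have hsub : Icc (0 : ℝ) 1 ×ˢ ball y ρ ⊆ Icc 0 1 ×ˢ (extChartAt 𝓘(ℝ, E) x₀).target :=
    prod_mono le_rfl hρt
  have hmem : (s₀, y) ∈ Icc (0 : ℝ) 1 ×ˢ ball y ρ := ⟨hs₀, mem_ball_self hρ⟩
  have hc := ((hV x₀).mono hsub) (s₀, y) hmem
  obtain ⟨K, t, ht, hlip⟩ := hc.exists_lipschitzOnWith ((convex_Icc _ _).prod (convex_ball _ _))
  have hbd := hc.continuousWithinAt.norm.eventually_lt_const
    (lt_add_one ‖coordField V x₀ s₀ y‖)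
  obtain ⟨δ, hδ, hball⟩ := Metric.mem_nhdsWithin_iff.1 (Filter.inter_mem ht hbd)
  have key : ∀ s ∈ Icc (0 : ℝ) 1, dist s s₀ < min δ ρ → ∀ z ∈ ball y (min δ ρ),
      (s, z) ∈ t ∧ ‖coordField V x₀ s z‖ < ‖coordField V x₀ s₀ y‖ + 1 := by
    intro s hs hd z hz
    have hz' := mem_ball.1 hz
    refine hball ⟨?_, hs, mem_ball.2 (hz'.trans_le (min_le_right _ _))⟩
    rw [mem_ball, Prod.dist_eq]
    exact max_lt (hd.trans_le (min_le_left _ _)) (hz'.trans_le (min_le_left _ _))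
  refine ⟨min δ ρ, lt_min hδ hρ, (ball_subset_ball (min_le_right _ _)).trans hρt, K,
    ⟨‖coordField V x₀ s₀ y‖ + 1, by positivity⟩, fun s hs hd => ⟨?_, fun z hz => ?_⟩⟩
  · refine LipschitzOnWith.of_dist_le_mul fun z hz w hw => ?_
    have := hlip.dist_le_mul (s, z) (key s hs hd z hz).1 (s, w) (key s hs hd w hw).1
    simpa [Prod.dist_eq] using this
  · exact (key s hs hd z hz).2.le

variable [IsManifold 𝓘(ℝ, E) ∞ M] [T2Space M]

/-- Continuous induction along `[a, b]`: the set of agreement is closed since `M` is Hausdorff, and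
it extends to the right of each of its points by uniqueness in a chart. -/
theorem IsSolutionOn.eqOn (hV : IsC1Field V) {γ₁ γ₂ : ℝ → M} {a b : ℝ} (ha : 0 ≤ a) (hb : b ≤ 1)
    (h₁ : IsSolutionOn V γ₁ (Icc a b)) (h₂ : IsSolutionOn V γ₂ (Icc a b)) (h : γ₁ a = γ₂ a) :
    EqOn γ₁ γ₂ (Icc a b) := by
  have hcl : IsClosed ({s | γ₁ s = γ₂ s} ∩ Icc a b) := by
    have := (h₁.continuousOn.prodMk h₂.continuousOn).preimage_isClosed_of_isClosed isClosed_Icc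
      (isClosed_diagonal (X := M))
    rwa [inter_comm] at this
  refine hcl.Icc_subset_of_forall_mem_nhdsWithin h ?_
  rintro x ⟨hx : γ₁ x = γ₂ x, hxa, hxb⟩
  have hxI : x ∈ Icc a b := ⟨hxa, hxb.le⟩
  obtain ⟨δ, hδ, -, K, L, hKL⟩ := hV.exists_lipschitzOnWith (γ₁ x) (s₀ := x)
    ⟨ha.trans hxa, hxb.le.trans hb⟩ (mem_extChartAt_target (I := 𝓘(ℝ, E)) (γ₁ x))
  set ψ := extChartAt 𝓘(ℝ, E) (γ₁ x) with hψ
  have near : ∀ γ : ℝ → M, IsSolutionOn V γ (Icc a b) → γ x = γ₁ x →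
      ∀ᶠ s in 𝓝[≥] x, γ s ∈ ψ.source ∧ ψ (γ s) ∈ ball (ψ (γ₁ x)) δ := by
    intro γ hγ hγx
    have hc : ContinuousWithinAt γ (Ici x) x := by
      refine (hγ x hxI).continuousWithinAt.mono_of_mem_nhdsWithin ?_
      exact Filter.mem_of_superset (Icc_mem_nhdsGE hxb) (Icc_subset_Icc_left hxa)
    have h1 : ψ.source ∩ ψ ⁻¹' ball (ψ (γ₁ x)) δ ∈ 𝓝 (γ₁ x) :=
      Filter.inter_mem (extChartAt_source_mem_nhds _)
        ((continuousAt_extChartAt (γ₁ x)).preimage_mem_nhds (ball_mem_nhds _ hδ))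
    rw [← hγx] at h1
    have := hc.preimage_mem_nhdsWithin h1
    filter_upwards [this] with s hs
    rw [← hγx]
    exact hs
  have hev : ∀ᶠ s in 𝓝[≥] x, s ∈ Icc x b ∧ dist s x < δ :=
    Filter.inter_mem (Icc_mem_nhdsGE hxb) (mem_nhdsWithin_of_mem_nhds (ball_mem_nhds x hδ))
  obtain ⟨c, hxc, hc⟩ := (mem_nhdsGE_iff_exists_Icc_subset).1
    ((near γ₁ h₁ rfl).and ((near γ₂ h₂ hx.symm).and hev))
  have hsol : ∀ γ : ℝ → M, IsSolutionOn V γ (Icc a b) →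
      (∀ s ∈ Icc x c, γ s ∈ ψ.source) →
      ∀ s ∈ Icc x c, HasDerivWithinAt (fun τ => ψ (γ τ)) (coordField V (γ₁ x) s (ψ (γ s)))
        (Icc a b) s := fun γ hγ hs s hsc =>
    (hγ s ⟨hxa.trans hsc.1, (hc hsc).2.2.1.2⟩).hasDerivWithinAt_extChartAt (hs s hsc)
  have hcb : c ≤ b := (hc (right_mem_Icc.2 (le_of_lt hxc))).2.2.1.2
  have hIcc : ∀ s ∈ Ico x c, Icc a b ∈ 𝓝[≥] s := fun s hs =>
    Filter.mem_of_superset (Icc_mem_nhdsGE (hs.2.trans_le hcb))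
      (Icc_subset_Icc_left (hxa.trans hs.1))
  have heq := ODE_solution_unique_of_mem_Icc_right (v := coordField V (γ₁ x))
    (s := fun _ => ball (ψ (γ₁ x)) δ) (K := K)
    (f := fun τ => ψ (γ₁ τ)) (g := fun τ => ψ (γ₂ τ)) (a := x) (b := c)
    (fun t ht => (hKL t ⟨ha.trans (hxa.trans ht.1), ht.2.le.trans (hcb.trans hb)⟩
      (hc (Ico_subset_Icc_self ht)).2.2.2).1)
    (fun t ht => ((hsol γ₁ h₁ (fun s hs => (hc hs).1.1) t ht).continuousWithinAt).mono
      (Icc_subset_Icc hxa hcb))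
    (fun t ht => (hsol γ₁ h₁ (fun s hs => (hc hs).1.1) t
      (Ico_subset_Icc_self ht)).mono_of_mem_nhdsWithin (hIcc t ht))
    (fun t ht => (hc (Ico_subset_Icc_self ht)).1.2)
    (fun t ht => ((hsol γ₂ h₂ (fun s hs => (hc hs).2.1.1) t ht).continuousWithinAt).mono
      (Icc_subset_Icc hxa hcb))
    (fun t ht => (hsol γ₂ h₂ (fun s hs => (hc hs).2.1.1) t
      (Ico_subset_Icc_self ht)).mono_of_mem_nhdsWithin (hIcc t ht))
    (fun t ht => (hc (Ico_subset_Icc_self ht)).2.1.2) (by simp only [hx])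
  refine Filter.mem_of_superset (Ioc_mem_nhdsGT hxc) fun s hs => ?_
  have hs' := Ioc_subset_Icc_self hs
  exact ψ.injOn (hc hs').1.1 (hc hs').2.1.1 (heq hs')

variable [CompleteSpace E]

/-- Over short time intervals, the endpoint of a solution is a continuous function of its starting
point. -/
theorem IsC1Field.exists_local_flow (hV : IsC1Field V) {s₀ : ℝ} (hs₀ : s₀ ∈ Icc (0 : ℝ) 1)
    (p : M) : ∃ ε > 0, ∃ W : Set M, IsOpen W ∧ p ∈ W ∧ ∀ a b : ℝ, 0 ≤ a → a ≤ b → b ≤ 1 →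
      dist a s₀ < ε → dist b s₀ < ε → ∃ Φ : M → M, ContinuousOn Φ W ∧
        ∀ γ : ℝ → M, IsSolutionOn V γ (Icc a b) → γ a ∈ W → γ b = Φ (γ a) := by
  obtain ⟨δ, hδ, htar, K, L, hKL⟩ := hV.exists_lipschitzOnWith p hs₀
    (mem_extChartAt_target (I := 𝓘(ℝ, E)) p)
  set ψ := extChartAt 𝓘(ℝ, E) p with hψ
  have hL : (0 : ℝ) ≤ L := L.2
  -- Starting points lie within `δ / 4` of the centre and solutions may use radius `δ / 2`. Times
  -- within `δ / (8 * (L + 1))` of `s₀` give `L * (b - a) ≤ δ / 4`, which is exactly the room left.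
  refine ⟨min δ (δ / (8 * (L + 1))), lt_min hδ (by positivity),
    ψ.source ∩ ψ ⁻¹' ball (ψ p) (δ / 4), ?_, ⟨mem_extChartAt_source p, ?_⟩, ?_⟩
  · exact (continuousOn_extChartAt p).isOpen_inter_preimage (isOpen_extChartAt_source p)
      isOpen_ball
  · exact mem_ball_self (by positivity)
  intro a b ha hab hb has hbs
  have hdist : ∀ t ∈ Icc a b, dist t s₀ < δ := by
    intro t ht
    have h1 := has.trans_le (min_le_left _ _)
    have h2 := hbs.trans_le (min_le_left _ _)
    rw [Real.dist_eq, abs_lt] at *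
    exact ⟨by linarith [ht.1], by linarith [ht.2]⟩
  have ht01 : ∀ t ∈ Icc a b, t ∈ Icc (0 : ℝ) 1 := fun t ht => ⟨ha.trans ht.1, ht.2.trans hb⟩
  have hsub : closedBall (ψ p) (δ / 2) ⊆ ball (ψ p) δ := closedBall_subset_ball (by linarith)
  have hPL : IsPicardLindelof (coordField V p) (tmin := a) (tmax := b) ⟨a, left_mem_Icc.2 hab⟩
      (ψ p) ⟨δ / 2, by positivity⟩ ⟨δ / 4, by positivity⟩ L K := by
    refine ⟨fun t ht => (hKL t (ht01 t ht) (hdist t ht)).1.mono hsub, fun x hx => ?_,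
      fun t ht x hx => (hKL t (ht01 t ht) (hdist t ht)).2 x (hsub hx), ?_⟩
    · exact (hV p).continuousOn.comp (f := fun t : ℝ => (t, x)) (by fun_prop)
        fun t ht => ⟨ht01 t ht, htar (hsub hx)⟩
    · have h1 := has.trans_le (min_le_right _ _)
      have h2 := hbs.trans_le (min_le_right _ _)
      rw [Real.dist_eq, abs_lt] at h1 h2
      have h3 : b - a ≤ 2 * (δ / (8 * (L + 1))) := by linarith
      have h4 : (L : ℝ) * (2 * (δ / (8 * (L + 1)))) ≤ δ / 4 := by
        have : (L : ℝ) * (2 * (δ / (8 * (L + 1)))) = (L / (L + 1)) * (δ / 4) := by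
          field_simp; ring
        rw [this]
        have h5 : (L : ℝ) / (L + 1) ≤ 1 := by rw [div_le_one (by positivity)]; linarith
        nlinarith
      have h6 : max (b - a) (a - a) = b - a := max_eq_left (by linarith)
      change (L : ℝ) * max (b - a) (a - a) ≤ δ / 2 - δ / 4
      rw [h6]
      have := mul_le_mul_of_nonneg_left h3 hL
      linarith
  obtain ⟨α, hα, L', hL'⟩ := hPL.exists_flow_mem_closedBall
  have hba : b ∈ Icc a b := right_mem_Icc.2 hab
  refine ⟨fun m => ψ.symm (α (ψ m) b), ?_, ?_⟩
  · have h1 : ContinuousOn (fun m => α (ψ m) b) (ψ.source ∩ ψ ⁻¹' ball (ψ p) (δ / 4)) :=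
      (hL' b hba).continuousOn.comp ((continuousOn_extChartAt p).mono inter_subset_left)
        fun m hm => ball_subset_closedBall hm.2
    exact (continuousOn_extChartAt_symm p).comp h1 fun m hm =>
      htar (hsub ((hα (ψ m) (ball_subset_closedBall hm.2)).2.1 b))
  · intro γ hγ hγW
    obtain ⟨hα0, hαb, hαd⟩ := hα (ψ (γ a)) (ball_subset_closedBall hγW.2)
    have hsol : IsSolutionOn V (fun t => ψ.symm (α (ψ (γ a)) t)) (Icc a b) := fun s hs =>
      (hαd s hs).hasMFDerivWithinAt_extChartAt_symm (htar (hsub (hαb s)))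
    refine hγ.eqOn hV ha hb hsol ?_ hba
    rw [hα0, ψ.left_inv hγW.1]

/-- Solutions on `[0, 1]` depend continuously on the initial value. -/
theorem IsC1Field.continuousWithinAt_solution (hV : IsC1Field V) {X : Set M} {Γ : M → ℝ → M}
    (hΓ : ∀ x ∈ X, IsSolutionOn V (Γ x) (Icc 0 1)) (h0 : ∀ x ∈ X, Γ x 0 = x) {x₀ : M}
    (hx₀ : x₀ ∈ X) {t : ℝ} (ht : t ∈ Icc (0 : ℝ) 1) :
    ContinuousWithinAt (fun x => Γ x t) X x₀ := by
  -- The times up to which continuity at `x₀` is known. A local flow around the point reached at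
  -- time `sSup A` carries continuity past that time unless it is already `1`.
  set A : Set ℝ := {t ∈ Icc (0 : ℝ) 1 | ∀ s ∈ Icc 0 t,
    ContinuousWithinAt (fun x => Γ x s) X x₀} with hA
  have hA0 : (0 : ℝ) ∈ A := by
    refine ⟨by simp, fun s hs => ?_⟩
    obtain rfl : s = 0 := le_antisymm hs.2 hs.1
    exact continuousWithinAt_id.congr (fun x hx => h0 x hx) (h0 x₀ hx₀)
  have hAb : BddAbove A := ⟨1, fun t ht => ht.1.2⟩
  set c := sSup A with hc
  have hc0 : 0 ≤ c := le_csSup hAb hA0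
  have hc1 : c ≤ 1 := csSup_le ⟨0, hA0⟩ fun t ht => ht.1.2
  obtain ⟨ε, hε, W, hWo, hpW, hloc⟩ := hV.exists_local_flow ⟨hc0, hc1⟩ (Γ x₀ c)
  have hcont : Γ x₀ ⁻¹' W ∈ 𝓝[Icc 0 1] c :=
    ((hΓ x₀ hx₀).continuousOn c ⟨hc0, hc1⟩).preimage_mem_nhdsWithin (hWo.mem_nhds hpW)
  obtain ⟨η, hη, hηW⟩ := Metric.mem_nhdsWithin_iff.1 hcont
  obtain ⟨a, haA, hac⟩ := exists_lt_of_lt_csSup ⟨0, hA0⟩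
    (show c - min ε η < sSup A by linarith [lt_min hε hη])
  have hac' : a ≤ c := le_csSup hAb haA
  have had : dist a c < min ε η := by
    rw [Real.dist_eq, abs_lt]; constructor <;> linarith [lt_min hε hη]
  have haW : Γ x₀ a ∈ W := hηW ⟨had.trans_le (min_le_right _ _), haA.1⟩
  -- For starting points near `x₀` the position at time `b` is a fixed continuous function `Φ` of
  -- the position at time `a`, where continuity is known.
  have step : ∀ b, a ≤ b → b ≤ 1 → b < c + ε → ContinuousWithinAt (fun x => Γ x b) X x₀ := by
    intro b hab hb1 hbc
    obtain ⟨Φ, hΦ, hΦγ⟩ := hloc a b haA.1.1 hab hb1 (had.trans_le (min_le_left _ _)) (by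
      rw [Real.dist_eq, abs_lt]
      constructor <;> linarith [min_le_left ε η])
    have hca := haA.2 a ⟨haA.1.1, le_rfl⟩
    have heq : ∀ x ∈ X, Γ x a ∈ W → Γ x b = Φ (Γ x a) := fun x hx hxW =>
      hΦγ _ ((hΓ x hx).mono (Icc_subset_Icc haA.1.1 hb1)) hxW
    have h1 : ContinuousWithinAt (fun x => Φ (Γ x a)) X x₀ :=
      ContinuousAt.comp_continuousWithinAt (f := fun x => Γ x a)
        (hΦ.continuousAt (hWo.mem_nhds haW)) hca
    refine h1.congr_of_eventuallyEq ?_ (heq x₀ hx₀ haW)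
    filter_upwards [hca.preimage_mem_nhdsWithin (hWo.mem_nhds haW), self_mem_nhdsWithin]
      with x hxW hx using heq x hx hxW
  have hbA : min 1 (c + ε / 2) ∈ A := by
    refine ⟨⟨le_min zero_le_one (by linarith), min_le_left _ _⟩, fun s hs => ?_⟩
    rcases le_total s a with hsa | hsa
    · exact haA.2 s ⟨hs.1, hsa⟩
    · exact step s hsa (hs.2.trans (min_le_left _ _))
        ((hs.2.trans (min_le_right _ _)).trans_lt (by linarith))
  have hle : min 1 (c + ε / 2) ≤ c := le_csSup hAb hbA
  have h1 : (1 : ℝ) ≤ c + ε / 2 := by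
    by_contra hcon
    rw [min_eq_right (by linarith)] at hle
    linarith
  rw [min_eq_left h1] at hbA
  exact hbA.2 t ht

end

/-! ### Hamiltonian vector fields: existence, uniqueness and smoothness -/

section

variable {E : Type*} [NormedAddCommGroup E] [NormedSpace ℝ E]

theorem exists_continuousLinearEquiv_eq_of_nondegenerate [FiniteDimensional ℝ E]
    (B : E →L[ℝ] E →L[ℝ] ℝ) (hB : ∀ v, (∀ w, B v w = 0) → v = 0) :
    ∃ e : E ≃L[ℝ] (E →L[ℝ] ℝ), (e : E →L[ℝ] E →L[ℝ] ℝ) = B := by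
  have hinj : Function.Injective B := by
    refine (injective_iff_map_eq_zero B).2 fun v hv => hB v fun w => ?_
    rw [hv]; rfl
  have hfin : Module.finrank ℝ E = Module.finrank ℝ (E →L[ℝ] ℝ) := by
    rw [← (LinearMap.toContinuousLinearMap (𝕜 := ℝ) (E := E) (F' := ℝ)).finrank_eq]
    exact (Subspace.dual_finrank_eq).symm
  refine ⟨(LinearEquiv.ofInjectiveOfFinrankEq (B : E →ₗ[ℝ] E →L[ℝ] ℝ) hinj
    hfin).toContinuousLinearEquiv, ?_⟩
  ext v w
  rfl

/-- Partial derivatives in the space variable of a function which is smooth on `[0, 1] × O`. -/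
theorem ContDiffOn.fderiv_snd {G : Type*} [NormedAddCommGroup G] [NormedSpace ℝ G]
    {f : ℝ × E → G} {O : Set E} (hO : IsOpen O) (hf : ContDiffOn ℝ ∞ f (Icc 0 1 ×ˢ O)) :
    ContDiffOn ℝ ∞ (fun p : ℝ × E => fderiv ℝ (fun y => f (p.1, y)) p.2) (Icc 0 1 ×ˢ O) := by
  have hU : UniqueDiffOn ℝ (Icc (0 : ℝ) 1 ×ˢ O) :=
    (uniqueDiffOn_Icc zero_lt_one).prod hO.uniqueDiffOn
  have h1 : ContDiffOn ℝ ∞ (fun p => (fderivWithin ℝ f (Icc 0 1 ×ˢ O) p).comp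
      (ContinuousLinearMap.inr ℝ ℝ E)) (Icc 0 1 ×ˢ O) :=
    (hf.fderivWithin hU (by simp)).clm_comp contDiffOn_const
  refine h1.congr fun p hp => ?_
  have h2 := ((hf.differentiableOn (by simp)) p hp).hasFDerivWithinAt
  have h3 : HasFDerivWithinAt (fun y : E => (p.1, y)) (ContinuousLinearMap.inr ℝ ℝ E) O p.2 :=
    (hasFDerivAt_prodMk_right p.1 p.2).hasFDerivWithinAt
  have h4 : HasFDerivWithinAt (fun y => f (p.1, y)) ((fderivWithin ℝ f (Icc 0 1 ×ˢ O) p).comp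
      (ContinuousLinearMap.inr ℝ ℝ E)) O p.2 :=
    HasFDerivWithinAt.comp (t := Icc (0 : ℝ) 1 ×ˢ O) p.2 h2 h3 fun y hy => ⟨hp.1, hy⟩
  exact (h4.hasFDerivAt (hO.mem_nhds hp.2)).fderiv

variable {M : Type*} [TopologicalSpace M] [ChartedSpace E M]

/-- The differential of a real function. -/
def scalarDeriv (f : M → ℝ) (x : M) : TangentSpace 𝓘(ℝ, E) x →L[ℝ] ℝ :=
  mfderiv 𝓘(ℝ, E) 𝓘(ℝ, ℝ) f x

/-- In finite dimension a nondegenerate form maps the tangent space onto its dual, so the choice in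
`hamVectorField` is never a default value. -/
theorem IsNondegenerateForm.hamVectorField_spec [FiniteDimensional ℝ E] {om : TangentBilin E M}
    (h : IsNondegenerateForm om) (H : ℝ → M → ℝ) (t : ℝ) (x : M) (w : TangentSpace 𝓘(ℝ, E) x) :
    om x (hamVectorField om H t x) w = scalarDeriv (H t) x w := by
  obtain ⟨e, he⟩ := exists_continuousLinearEquiv_eq_of_nondegenerate (E := E) (om x) (h x)
  obtain ⟨v, hv⟩ := e.surjective (scalarDeriv (H t) x)
  have hex : ∃ v : TangentSpace 𝓘(ℝ, E) x,
      ∀ w, om x v w = scalarDeriv (H t) x w := by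
    refine ⟨v, fun w => ?_⟩
    rw [← hv, ← he]
    rfl
  exact Classical.epsilon_spec hex w

theorem IsNondegenerateForm.hamVectorField_eq [FiniteDimensional ℝ E] {om : TangentBilin E M}
    (h : IsNondegenerateForm om) {H : ℝ → M → ℝ} {t : ℝ} {x : M} {v : TangentSpace 𝓘(ℝ, E) x}
    (hv : ∀ w, om x v w = scalarDeriv (H t) x w) :
    hamVectorField om H t x = v := by
  refine sub_eq_zero.1 (h x _ fun w => ?_)
  rw [map_sub, sub_apply, h.hamVectorField_spec, hv, sub_self]

/-- Smoothness of a time-dependent function on `[0, 1] × M`. -/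
def IsSmoothHam (H : ℝ → M → ℝ) : Prop :=
  ContMDiffOn (𝓘(ℝ, ℝ).prod 𝓘(ℝ, E)) 𝓘(ℝ, ℝ) ∞ (fun p : ℝ × M => H p.1 p.2)
      (Icc 0 1 ×ˢ univ)

theorem IsSmoothHam.contMDiff {H : ℝ → M → ℝ} (hH : IsSmoothHam (E := E) H) {t : ℝ}
    (ht : t ∈ Icc (0 : ℝ) 1) : ContMDiff 𝓘(ℝ, E) 𝓘(ℝ, ℝ) ∞ (H t) := by
  rw [← contMDiffOn_univ]
  exact ContMDiffOn.comp (g := fun p : ℝ × M => H p.1 p.2) (f := fun x => (t, x)) hH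
    (contMDiffOn_const.prodMk contMDiffOn_id) fun x _ => ⟨ht, mem_univ x⟩

theorem IsSmoothHam.hasMFDerivAt {H : ℝ → M → ℝ} (hH : IsSmoothHam (E := E) H) {t : ℝ}
    (ht : t ∈ Icc (0 : ℝ) 1) (x : M) :
    HasMFDerivAt 𝓘(ℝ, E) 𝓘(ℝ, ℝ) (H t) x (scalarDeriv (H t) x) :=
  ((hH.contMDiff ht).mdifferentiableAt (by simp)).hasMFDerivAt

variable [IsManifold 𝓘(ℝ, E) ∞ M]

theorem IsSmoothHam.contDiffOn_coord {H : ℝ → M → ℝ} (hH : IsSmoothHam (E := E) H) (x₀ : M) :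
    ContDiffOn ℝ ∞ (fun p : ℝ × E => H p.1 ((extChartAt 𝓘(ℝ, E) x₀).symm p.2))
      (Icc 0 1 ×ˢ (extChartAt 𝓘(ℝ, E) x₀).target) := by
  rw [← contMDiffOn_iff_contDiffOn]
  refine ContMDiffOn.comp (g := fun p : ℝ × M => H p.1 p.2)
    (f := fun p : ℝ × E => (p.1, (extChartAt 𝓘(ℝ, E) x₀).symm p.2)) hH
    (contDiff_fst.contMDiff.contMDiffOn.prodMk
      ((contMDiffOn_extChartAt_symm x₀).comp contDiff_snd.contMDiff.contMDiffOn
        fun p hp => hp.2)) fun p hp => ⟨hp.1, mem_univ _⟩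

theorem IsSmoothHam.scalarDeriv_chartSymmDeriv {H : ℝ → M → ℝ} (hH : IsSmoothHam (E := E) H) {t : ℝ}
    (ht : t ∈ Icc (0 : ℝ) 1) {x₀ : M} {y : E} (hy : y ∈ (extChartAt 𝓘(ℝ, E) x₀).target) (w : E) :
    scalarDeriv (H t) ((extChartAt 𝓘(ℝ, E) x₀).symm y) (chartSymmDeriv x₀ y w) =
      fderiv ℝ (fun z => H t ((extChartAt 𝓘(ℝ, E) x₀).symm z)) y w := by
  have h := (hH.hasMFDerivAt ht _).comp y (hasMFDerivAt_extChartAt_symm hy)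
  have h2 : HasFDerivAt (fun z => H t ((extChartAt 𝓘(ℝ, E) x₀).symm z))
      ((scalarDeriv (H t) ((extChartAt 𝓘(ℝ, E) x₀).symm y)).comp (chartSymmDeriv x₀ y)) y :=
    HasMFDerivAt.hasFDerivAt h
  rw [h2.fderiv]
  rfl

theorem IsNondegenerateForm.coordForm_coordField [FiniteDimensional ℝ E] {om : TangentBilin E M}
    (h : IsNondegenerateForm om) {H : ℝ → M → ℝ} (hH : IsSmoothHam (E := E) H) {t : ℝ}
    (ht : t ∈ Icc (0 : ℝ) 1) {x₀ : M} {y : E} (hy : y ∈ (extChartAt 𝓘(ℝ, E) x₀).target) :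
    coordForm om x₀ y (coordField (hamVectorField om H) x₀ t y) =
      fderiv ℝ (fun z => H t ((extChartAt 𝓘(ℝ, E) x₀).symm z)) y := by
  ext w
  rw [coordForm_apply, chartSymmDeriv_coordField _ hy, h.hamVectorField_spec,
    hH.scalarDeriv_chartSymmDeriv ht hy]

theorem IsNondegenerateForm.eq_zero_of_coordForm {om : TangentBilin E M}
    (h : IsNondegenerateForm om) {x₀ : M} {y : E} (hy : y ∈ (extChartAt 𝓘(ℝ, E) x₀).target)
    (v : E) (hv : ∀ w, coordForm om x₀ y v w = 0) : v = 0 := by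
  have h1 : chartSymmDeriv x₀ y v = 0 := h _ _ fun w => by
    rw [← chartSymmDeriv_chartDeriv hy w]
    exact hv _
  rw [← chartDeriv_chartSymmDeriv hy v, h1, map_zero]

-- In coordinates the field is the inverse of the form applied to the differential of `H`, and
-- inversion of operators is smooth. Smoothness of the form is asked only on an open `O` so that the
-- result also serves the pulled back form on a submanifold.
set_option synthInstance.maxHeartbeats 100000 in
theorem IsNondegenerateForm.contDiffOn_coordField [FiniteDimensional ℝ E]
    {om : TangentBilin E M} (h : IsNondegenerateForm om) {H : ℝ → M → ℝ}
    (hH : IsSmoothHam (E := E) H) {x₀ : M} {O : Set E} (hO : IsOpen O)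
    (hOt : O ⊆ (extChartAt 𝓘(ℝ, E) x₀).target) (hom : ContDiffOn ℝ ∞ (coordForm om x₀) O) :
    ContDiffOn ℝ ∞ (fun p : ℝ × E => coordField (hamVectorField om H) x₀ p.1 p.2)
      (Icc 0 1 ×ˢ O) := by
  have hD := ((hH.contDiffOn_coord x₀).mono (prod_mono le_rfl hOt)).fderiv_snd hO
  have hom' : ContDiffOn ℝ ∞ (fun p : ℝ × E => coordForm om x₀ p.2) (Icc 0 1 ×ˢ O) :=
    hom.comp contDiff_snd.contDiffOn fun p hp => hp.2
  have hinv : ContDiffOn ℝ ∞ (fun p : ℝ × E => (coordForm om x₀ p.2).inverse)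
      (Icc 0 1 ×ˢ O) := by
    intro p hp
    obtain ⟨e, he⟩ := exists_continuousLinearEquiv_eq_of_nondegenerate _
      (h.eq_zero_of_coordForm (hOt hp.2))
    have hi : ContDiffAt ℝ ∞ (ContinuousLinearMap.inverse : (E →L[ℝ] E →L[ℝ] ℝ) → _)
        (coordForm om x₀ p.2) := by
      rw [← he]
      exact contDiffAt_map_inverse e
    exact hi.comp_contDiffWithinAt p (hom' p hp)
  refine (hinv.clm_apply hD).congr fun p hp => ?_
  obtain ⟨e, he⟩ := exists_continuousLinearEquiv_eq_of_nondegenerate _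
    (h.eq_zero_of_coordForm (hOt hp.2))
  rw [← h.coordForm_coordField hH hp.1 (hOt hp.2), ← he, ContinuousLinearMap.inverse_equiv]
  simp

/-- The inverse chart carries constant vector fields to smooth sections of the tangent bundle.
Pairing the smooth section `om` with two of them gives the matrix entries of the coordinate form. -/
theorem IsSymplecticForm.contDiffOn_coordForm [FiniteDimensional ℝ E] {om : TangentBilin E M}
    (h : IsSymplecticForm om) (x₀ : M) :
    ContDiffOn ℝ ∞ (coordForm om x₀) (extChartAt 𝓘(ℝ, E) x₀).target := by
  have hsec : ∀ u : E, ContMDiffOn 𝓘(ℝ, E) (𝓘(ℝ, E).prod 𝓘(ℝ, E)) ∞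
      (fun y => TotalSpace.mk' E (E := fun x : M => TangentSpace 𝓘(ℝ, E) x)
        ((extChartAt 𝓘(ℝ, E) x₀).symm y) (chartSymmDeriv x₀ y u))
      (extChartAt 𝓘(ℝ, E) x₀).target := by
    intro u
    have ho := isOpen_extChartAt_target (I := 𝓘(ℝ, E)) x₀
    have h1 := (contMDiffOn_extChartAt_symm (I := 𝓘(ℝ, E)) (n := ∞) x₀).contMDiffOn_tangentMapWithin
      (m := ∞) (by simp) ho.uniqueMDiffOn
    have h2 : ContMDiff 𝓘(ℝ, E) 𝓘(ℝ, E).tangent ∞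
        (fun y : E => (TotalSpace.mk' E (E := fun x : E => TangentSpace 𝓘(ℝ, E) x) y u)) := by
      refine contMDiff_vectorSpace_iff_contDiff.2 contDiff_const
    refine (h1.comp h2.contMDiffOn fun y hy => hy).congr fun y hy => ?_
    simp only [Function.comp_def, tangentMapWithin]
    rw [mfderivWithin_eq_mfderiv (ho.uniqueMDiffWithinAt hy)
      (hasMFDerivAt_extChartAt_symm hy).mdifferentiableAt]
    rfl
  have hsm := h.smooth.contMDiffOn (s := univ) |>.comp (contMDiffOn_extChartAt_symm (n := ∞) x₀)
    (fun _ _ => mem_univ _)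
  refine contDiffOn_clm_apply.2 fun u => contDiffOn_clm_apply.2 fun w => ?_
  have := ContMDiffOn.clm_bundle_apply₂ (E₃ := Bundle.Trivial M ℝ) (F₃ := ℝ) hsm (hsec u) (hsec w)
  rw [← contMDiffOn_iff_contDiffOn]
  intro y hy
  have h3 := this y hy
  rw [contMDiffWithinAt_totalSpace] at h3
  exact h3.2

end

/-! ### Flow lines and the flow of a compatible field -/

section FlowLines

variable {E : Type*} [NormedAddCommGroup E] [NormedSpace ℝ E]
  {M : Type*} [TopologicalSpace M] [ChartedSpace E M]
  {V : ℝ → ∀ x : M, TangentSpace 𝓘(ℝ, E) x}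

theorem IsFlowLine.mono {t s : ℝ} {x : M} {γ : ℝ → M} (h : IsFlowLine V t x γ) (hst : s ≤ t) :
    IsFlowLine V s x γ where
  smooth := h.smooth.mono (Icc_subset_Icc_right hst)
  initial := h.initial
  equation := IsSolutionOn.mono (V := V) h.equation (Icc_subset_Icc_right hst)

/-- The chain rule for reparametrizations of solutions. -/
theorem IsSolutionOn.comp_hasDerivWithinAt {γ : ℝ → M} {S T : Set ℝ} (h : IsSolutionOn V γ T)
    {χ : ℝ → ℝ} {c s : ℝ} (hχ : HasDerivWithinAt χ c S s) (hST : MapsTo χ S T) (hs : s ∈ S) :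
    HasMFDerivWithinAt 𝓘(ℝ, ℝ) 𝓘(ℝ, E) (γ ∘ χ) S s
      ((1 : ℝ →L[ℝ] ℝ).smulRight (c • V (χ s) (γ (χ s)))) := by
  refine ((h (χ s) (hST hs)).comp s hχ.hasFDerivWithinAt.hasMFDerivWithinAt
    hST).congr_mfderiv ?_
  ext
  change ((1 : ℝ) • c) • V (χ s) (γ (χ s)) = (1 : ℝ) • (c • V (χ s) (γ (χ s)))
  rw [smul_smul, smul_eq_mul]

variable [IsManifold 𝓘(ℝ, E) ∞ M] [T2Space M]

/-- Uniqueness of solutions makes the arbitrary choice in the definition of `flow` immaterial. -/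
theorem IsFlowLine.flow_eq (hV : IsC1Field V) {t : ℝ} (ht : t ∈ Icc (0 : ℝ) 1) {x : M}
    {γ : ℝ → M} (h : IsFlowLine V t x γ) : flow V t x = γ t := by
  have hex : ∃ γ : ℝ → M, IsFlowLine V t x γ := ⟨γ, h⟩
  rw [flow, dif_pos hex]
  exact IsSolutionOn.eqOn (V := V) hV le_rfl ht.2 hex.choose_spec.equation h.equation
    (hex.choose_spec.initial.trans h.initial.symm) ⟨ht.1, le_rfl⟩

theorem IsFlowLine.flow_eq_of_mem (hV : IsC1Field V) {x : M} {γ : ℝ → M}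
    (h : IsFlowLine V 1 x γ) {t : ℝ} (ht : t ∈ Icc (0 : ℝ) 1) : flow V t x = γ t :=
  (h.mono ht.2).flow_eq hV ht

theorem IsCompatible.exists_isFlowLine (hV : IsC1Field V) {X : Set M} (h : IsCompatible X V)
    {x : M} (hx : x ∈ X) :
    ∃ γ : ℝ → M, IsFlowLine V 1 x γ ∧ ∀ t ∈ Icc (0 : ℝ) 1, γ t = flow V t x ∧ γ t ∈ X := by
  obtain ⟨γ, hγ⟩ := h.1 hx
  refine ⟨γ, hγ, fun t ht => ⟨(hγ.flow_eq_of_mem hV ht).symm, ?_⟩⟩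
  rw [← hγ.flow_eq_of_mem hV ht, ← h.2 t ht]
  exact mem_image_of_mem _ hx

theorem IsCompatible.continuousOn_flow [CompleteSpace E] (hV : IsC1Field V) {X : Set M}
    (h : IsCompatible X V) {t : ℝ} (ht : t ∈ Icc (0 : ℝ) 1) : ContinuousOn (flow V t) X := by
  classical
  choose! Γ hΓ using fun x (hx : x ∈ X) => h.exists_isFlowLine hV hx
  intro x hx
  refine (hV.continuousWithinAt_solution (fun x hx => (hΓ x hx).1.equation)
    (fun x hx => (hΓ x hx).1.initial) hx ht).congr (fun y hy => ?_) ?_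
  · exact ((hΓ y hy).2 t ht).1.symm
  · exact ((hΓ x hx).2 t ht).1.symm

end FlowLines

/-! ### The group structure: constant, reversed and concatenated Hamiltonians -/

section Hamiltonians

variable {E : Type*} [NormedAddCommGroup E] [NormedSpace ℝ E]
  {M : Type*} [TopologicalSpace M] [ChartedSpace E M]

theorem IsSmoothHam.linear_combination {H K : ℝ → M → ℝ} (hH : IsSmoothHam (E := E) H)
    (hK : IsSmoothHam (E := E) K) {a b χ θ : ℝ → ℝ} (ha : ContDiff ℝ ∞ a) (hb : ContDiff ℝ ∞ b)
    (hχ : ContDiff ℝ ∞ χ) (hθ : ContDiff ℝ ∞ θ) (hχm : MapsTo χ (Icc 0 1) (Icc 0 1))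
    (hθm : MapsTo θ (Icc 0 1) (Icc 0 1)) :
    IsSmoothHam (E := E) (fun t => a t • H (χ t) + b t • K (θ t)) := by
  have key : ∀ {H : ℝ → M → ℝ} {a χ : ℝ → ℝ}, IsSmoothHam (E := E) H → ContDiff ℝ ∞ a →
      ContDiff ℝ ∞ χ → MapsTo χ (Icc 0 1) (Icc 0 1) →
      ContMDiffOn (𝓘(ℝ, ℝ).prod 𝓘(ℝ, E)) 𝓘(ℝ, ℝ) ∞ (fun p : ℝ × M => a p.1 • H (χ p.1) p.2)
        (Icc 0 1 ×ˢ univ) := by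
    intro H a χ hH ha hχ hχm
    refine (ha.contMDiff.comp contMDiff_fst).contMDiffOn.smul ?_
    exact ContMDiffOn.comp (g := fun p : ℝ × M => H p.1 p.2) (f := fun p : ℝ × M => (χ p.1, p.2)) hH
      ((hχ.contMDiff.comp contMDiff_fst).prodMk contMDiff_snd).contMDiffOn
      fun p hp => ⟨hχm hp.1, mem_univ _⟩
  exact (key hH ha hχ hχm).add (key hK hb hθ hθm)

variable [FiniteDimensional ℝ E]

theorem hamVectorField_linear_combination {om : TangentBilin E M} (hom : IsNondegenerateForm om)
    {H K L : ℝ → M → ℝ} (hH : IsSmoothHam (E := E) H) (hK : IsSmoothHam (E := E) K)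
    {s s' t : ℝ} (hs : s ∈ Icc (0 : ℝ) 1) (hs' : s' ∈ Icc (0 : ℝ) 1) {a b : ℝ}
    (hL : L t = a • H s + b • K s') (x : M) :
    hamVectorField om L t x = a • hamVectorField om H s x + b • hamVectorField om K s' x := by
  refine hom.hamVectorField_eq fun w => ?_
  have h1 : HasMFDerivAt 𝓘(ℝ, E) 𝓘(ℝ, ℝ) (L t) x
      (a • scalarDeriv (H s) x + b • scalarDeriv (K s') x) := by
    rw [hL]
    exact ((hH.hasMFDerivAt hs x).const_smul a).add ((hK.hasMFDerivAt hs' x).const_smul b)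
  have h2 : scalarDeriv (L t) x = a • scalarDeriv (H s) x + b • scalarDeriv (K s') x :=
    h1.mfderiv
  rw [h2, map_add, map_smul, map_smul]
  simp only [add_apply, smul_apply, hom.hamVectorField_spec]

variable [IsManifold 𝓘(ℝ, E) ∞ M]

theorem IsSymplecticForm.isC1Field {om : TangentBilin E M} (hom : IsSymplecticForm om)
    {H : ℝ → M → ℝ} (hH : IsSmoothHam (E := E) H) : IsC1Field (hamVectorField om H) := fun x₀ =>
  (hom.nondegenerate.contDiffOn_coordField hH (isOpen_extChartAt_target x₀) le_rfl
    (hom.contDiffOn_coordForm x₀)).of_le (by simp)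

variable [T2Space M] {om : TangentBilin E M} {X : Set M}

theorem zero_mem_compatibleHamiltonians (hom : IsSymplecticForm om) :
    (0 : ℝ → M → ℝ) ∈ compatibleHamiltonians om X ∧
      ∀ x, flow (hamVectorField om (0 : ℝ → M → ℝ)) 1 x = x := by
  have hsm : IsSmoothHam (E := E) (0 : ℝ → M → ℝ) := contMDiffOn_const
  have hzero : ∀ t x, hamVectorField om (0 : ℝ → M → ℝ) t x = 0 := fun t x => by
    refine hom.nondegenerate.hamVectorField_eq fun w => ?_
    have : scalarDeriv (E := E) ((0 : ℝ → M → ℝ) t) x = 0 := mfderiv_const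
    rw [this, map_zero]
  have hline : ∀ x, IsFlowLine (hamVectorField om (0 : ℝ → M → ℝ)) 1 x fun _ => x := fun x =>
    { smooth := contMDiffOn_const
      initial := rfl
      equation := fun s _ => by
        rw [hzero]
        refine (hasMFDerivWithinAt_const (I := 𝓘(ℝ, ℝ)) (I' := 𝓘(ℝ, E)) x _ s).congr_mfderiv ?_
        ext
        exact (smul_zero _).symm }
  have hflow : ∀ t ∈ Icc (0 : ℝ) 1, ∀ x, flow (hamVectorField om (0 : ℝ → M → ℝ)) t x = x :=
    fun t ht x => (hline x).flow_eq_of_mem (hom.isC1Field hsm) ht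
  refine ⟨⟨hsm, fun x _ => ⟨_, hline x⟩, fun t ht => ?_⟩, hflow 1 (by simp)⟩
  rw [image_congr fun x _ => hflow t ht x, image_id']

theorem exists_reverse_mem_compatibleHamiltonians (hom : IsSymplecticForm om)
    {H : ℝ → M → ℝ} (hH : H ∈ compatibleHamiltonians om X) :
    ∃ K ∈ compatibleHamiltonians om X, ∀ x ∈ X,
      flow (hamVectorField om K) 1 (flow (hamVectorField om H) 1 x) = x := by
  obtain ⟨hHs, hHc⟩ := hH
  have hC := hom.isC1Field hHs
  have hsymm : MapsTo (fun t : ℝ => 1 - t) (Icc 0 1) (Icc 0 1) := fun t ht =>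
    ⟨by linarith [ht.2], by linarith [ht.1]⟩
  -- The summand with coefficient `0` only brings `K` into the shape of a linear combination of two
  -- reparametrized Hamiltonians.
  set K : ℝ → M → ℝ := fun t => (-1 : ℝ) • H (1 - t) + (0 : ℝ) • H (1 - t) with hK
  have hKs : IsSmoothHam (E := E) K := IsSmoothHam.linear_combination hHs hHs contDiff_const
    contDiff_const (contDiff_const.sub contDiff_id) (contDiff_const.sub contDiff_id) hsymm hsymm
  have hKV : ∀ t ∈ Icc (0 : ℝ) 1, ∀ x,
      hamVectorField om K t x = (-1 : ℝ) • hamVectorField om H (1 - t) x := fun t ht x => by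
    rw [hamVectorField_linear_combination hom.nondegenerate hHs hHs (hsymm ht) (hsymm ht)
      (L := K) rfl x, zero_smul, add_zero]
  have hline : ∀ x ∈ X, ∃ γ, IsFlowLine (hamVectorField om K) 1
      (flow (hamVectorField om H) 1 x) γ ∧
      ∀ t ∈ Icc (0 : ℝ) 1, γ t = flow (hamVectorField om H) (1 - t) x := by
    intro x hx
    obtain ⟨γ, hγ, hγX⟩ := hHc.exists_isFlowLine hC hx
    refine ⟨γ ∘ fun t => 1 - t, ⟨?_, ?_, fun s hs => ?_⟩, fun t ht => (hγX _ (hsymm ht)).1⟩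
    · exact hγ.smooth.comp (contDiff_const.sub contDiff_id).contMDiff.contMDiffOn hsymm
    · simpa using (hγX 1 (by simp)).1
    · rw [hKV s hs]
      exact IsSolutionOn.comp_hasDerivWithinAt hγ.equation
        ((hasDerivWithinAt_id s _).const_sub 1) hsymm hs
  have hflow : ∀ x ∈ X, ∀ t ∈ Icc (0 : ℝ) 1,
      flow (hamVectorField om K) t (flow (hamVectorField om H) 1 x) =
        flow (hamVectorField om H) (1 - t) x := by
    intro x hx t ht
    obtain ⟨γ, hγ, hγt⟩ := hline x hx
    rw [hγ.flow_eq_of_mem (hom.isC1Field hKs) ht, hγt t ht]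
  have h1 := hHc.2 1 (by simp)
  refine ⟨K, ⟨hKs, fun y hy => ?_, fun t ht => ?_⟩, fun x hx => ?_⟩
  · rw [← h1] at hy
    obtain ⟨x, hx, rfl⟩ := hy
    obtain ⟨γ, hγ, -⟩ := hline x hx
    exact ⟨γ, hγ⟩
  · conv_lhs => rw [← h1, image_image]
    rw [image_congr fun x hx => hflow x hx t ht]
    exact hHc.2 _ (hsymm ht)
  · obtain ⟨γ, hγ, hγX⟩ := hHc.exists_isFlowLine hC hx
    rw [hflow x hx 1 (by simp), sub_self, ← (hγX 0 (by simp)).1, hγ.initial]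

/-- The function attains its global minimum `0` or maximum `1` at such points. -/
theorem Real.deriv_smoothTransition_eq_zero {x : ℝ} (hx : x ≤ 0 ∨ 1 ≤ x) :
    deriv Real.smoothTransition x = 0 := by
  rcases hx with hx | hx
  · refine IsLocalMin.deriv_eq_zero (Filter.Eventually.of_forall fun y => ?_)
    rw [Real.smoothTransition.zero_of_nonpos hx]
    exact Real.smoothTransition.nonneg y
  · refine IsLocalMax.deriv_eq_zero (Filter.Eventually.of_forall fun y => ?_)
    rw [Real.smoothTransition.one_of_one_le hx]
    exact Real.smoothTransition.le_one y

/-- A smooth time change which starts at `0` and is stationary after time `1 / 3`. -/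
theorem exists_early_time_change : ∃ χ χ' : ℝ → ℝ, ContDiff ℝ ∞ χ ∧ ContDiff ℝ ∞ χ' ∧
    (∀ t, HasDerivAt χ (χ' t) t) ∧ (∀ t, χ t ∈ Icc (0 : ℝ) 1) ∧ χ 0 = 0 ∧
    ∀ t, 1 / 3 ≤ t → χ t = 1 ∧ χ' t = 0 := by
  have hst : ContDiff ℝ ∞ Real.smoothTransition := Real.smoothTransition.contDiff
  have hder : ContDiff ℝ ∞ (deriv Real.smoothTransition) := (contDiff_infty_iff_deriv.1 hst).2
  refine ⟨fun t => Real.smoothTransition (3 * t),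
    fun t => deriv Real.smoothTransition (3 * t) * 3,
    hst.comp (contDiff_const.mul contDiff_id),
    (hder.comp (contDiff_const.mul contDiff_id)).mul contDiff_const, fun t => ?_,
    fun t => ⟨Real.smoothTransition.nonneg _, Real.smoothTransition.le_one _⟩, ?_,
    fun t ht => ⟨?_, ?_⟩⟩
  · have h1 := ((hst.differentiable (by simp)) (3 * t)).hasDerivAt
    have h2 : HasDerivAt (fun t : ℝ => 3 * t) 3 t := by
      simpa using (hasDerivAt_id t).const_mul (3 : ℝ)
    exact h1.comp t h2
  · simp
  · exact Real.smoothTransition.one_of_one_le (by linarith)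
  · change deriv Real.smoothTransition (3 * t) * 3 = 0
    rw [Real.deriv_smoothTransition_eq_zero (Or.inr (by linarith)), zero_mul]

/-- A smooth time change which ends at `1` and is stationary before time `2 / 3`. -/
theorem exists_late_time_change : ∃ θ θ' : ℝ → ℝ, ContDiff ℝ ∞ θ ∧ ContDiff ℝ ∞ θ' ∧
    (∀ t, HasDerivAt θ (θ' t) t) ∧ (∀ t, θ t ∈ Icc (0 : ℝ) 1) ∧ θ 1 = 1 ∧
    ∀ t, t ≤ 2 / 3 → θ t = 0 ∧ θ' t = 0 := by
  obtain ⟨χ, χ', hχ, hχ', hd, hm, h0, h1⟩ := exists_early_time_change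
  have hsub : ContDiff ℝ ∞ fun t : ℝ => 1 - t := contDiff_const.sub contDiff_id
  refine ⟨fun t => 1 - χ (1 - t), fun t => χ' (1 - t), contDiff_const.sub (hχ.comp hsub),
    hχ'.comp hsub, fun t => ?_, fun t => ?_, by simp [h0], fun t ht => ?_⟩
  · have := ((hd (1 - t)).comp t ((hasDerivAt_id t).const_sub 1)).const_sub 1
    simpa using this
  · have := hm (1 - t)
    exact ⟨by linarith [this.2], by linarith [this.1]⟩
  · have := h1 (1 - t) (by linarith)
    exact ⟨by simp [this.1], this.2⟩

/-- The Hamiltonian `χ' H_χ + θ' K_θ` follows `H` before time `1 / 3`, rests until `2 / 3` and then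
follows `K`. Its flow on `X` is `φ_H^χ` in the first half and `φ_K^θ ∘ φ_H^1` in the second. -/
theorem exists_concatenation_mem_compatibleHamiltonians (hom : IsSymplecticForm om)
    {H K : ℝ → M → ℝ} (hH : H ∈ compatibleHamiltonians om X)
    (hK : K ∈ compatibleHamiltonians om X) :
    ∃ L ∈ compatibleHamiltonians om X, ∀ x ∈ X, flow (hamVectorField om L) 1 x =
      flow (hamVectorField om K) 1 (flow (hamVectorField om H) 1 x) := by
  obtain ⟨hHs, hHc⟩ := hH
  obtain ⟨hKs, hKc⟩ := hK
  obtain ⟨χ, χ', hχ, hχ', hχd, hχm, hχ0, hχ1⟩ := exists_early_time_change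
  obtain ⟨θ, θ', hθ, hθ', hθd, hθm, hθ1, hθ0⟩ := exists_late_time_change
  set L : ℝ → M → ℝ := fun t => χ' t • H (χ t) + θ' t • K (θ t) with hL
  have hLs : IsSmoothHam (E := E) L := IsSmoothHam.linear_combination hHs hKs hχ' hθ' hχ hθ
    (fun t _ => hχm t) fun t _ => hθm t
  have hLV : ∀ t x, hamVectorField om L t x =
      χ' t • hamVectorField om H (χ t) x + θ' t • hamVectorField om K (θ t) x := fun t x =>
    hamVectorField_linear_combination hom.nondegenerate hHs hKs (hχm t) (hθm t) rfl x
  have hline : ∀ x ∈ X, ∃ Γ, IsFlowLine (hamVectorField om L) 1 x Γ ∧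
      (∀ t, t ≤ 2 / 3 → Γ t = flow (hamVectorField om H) (χ t) x) ∧
      ∀ t, 1 / 3 ≤ t → Γ t =
        flow (hamVectorField om K) (θ t) (flow (hamVectorField om H) 1 x) := by
    intro x hx
    obtain ⟨γ, hγ, hγX⟩ := hHc.exists_isFlowLine (hom.isC1Field hHs) hx
    obtain ⟨η, hη, hηX⟩ := hKc.exists_isFlowLine (hom.isC1Field hKs) (hγX 1 (by simp)).2
    set Γ : ℝ → M := fun t => if t ≤ 1 / 2 then γ (χ t) else η (θ t) with hΓ
    have hΓγ : ∀ t, t ≤ 2 / 3 → Γ t = (γ ∘ χ) t := by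
      intro t ht
      by_cases h : t ≤ 1 / 2
      · simp only [hΓ, if_pos h, Function.comp]
      · simp only [hΓ, if_neg h, Function.comp, (hθ0 t ht).1, hη.initial,
          (hχ1 t (by linarith)).1]
    have hΓη : ∀ t, 1 / 3 ≤ t → Γ t = (η ∘ θ) t := by
      intro t ht
      by_cases h : t ≤ 1 / 2
      · simp only [hΓ, if_pos h, Function.comp, (hχ1 t ht).1, hη.initial,
          (hθ0 t (by linarith)).1]
      · simp only [hΓ, if_neg h, Function.comp]
    -- Both descriptions of `Γ` are valid on the resting interval `[1 / 3, 2 / 3]`, so around every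
    -- time one of them holds on a whole neighbourhood; smoothness and the equation need no matching
    -- at `1 / 2`.
    have hnear : ∀ s, (Γ =ᶠ[𝓝 s] γ ∘ χ ∧ θ' s = 0) ∨ (Γ =ᶠ[𝓝 s] η ∘ θ ∧ χ' s = 0) := by
      intro s
      rcases le_total s (1 / 2) with h | h
      · refine Or.inl ⟨?_, (hθ0 s (by linarith)).2⟩
        filter_upwards [Iio_mem_nhds (show s < 2 / 3 by linarith)] with t ht
        exact hΓγ t (le_of_lt ht)
      · refine Or.inr ⟨?_, (hχ1 s (by linarith)).2⟩
        filter_upwards [Ioi_mem_nhds (show 1 / 3 < s by linarith)] with t ht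
        exact hΓη t (le_of_lt ht)
    refine ⟨Γ, ⟨fun s hs => ?_, ?_, fun s hs => ?_⟩, fun t ht => ?_, fun t ht => ?_⟩
    · rcases hnear s with ⟨h, -⟩ | ⟨h, -⟩
      · exact ((hγ.smooth.comp hχ.contMDiff.contMDiffOn fun t _ => hχm t) s
          hs).congr_of_eventuallyEq (h.filter_mono nhdsWithin_le_nhds) h.self_of_nhds
      · exact ((hη.smooth.comp hθ.contMDiff.contMDiffOn fun t _ => hθm t) s
          hs).congr_of_eventuallyEq (h.filter_mono nhdsWithin_le_nhds) h.self_of_nhds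
    · rw [hΓγ 0 (by norm_num), Function.comp, hχ0, hγ.initial]
    · rcases hnear s with ⟨h, h0⟩ | ⟨h, h0⟩
      · refine HasMFDerivWithinAt.congr_of_eventuallyEq (f := γ ∘ χ) ?_ (h.filter_mono nhdsWithin_le_nhds)
          h.self_of_nhds
        rw [hLV, h0, zero_smul, add_zero, h.self_of_nhds]
        exact IsSolutionOn.comp_hasDerivWithinAt hγ.equation (hχd s).hasDerivWithinAt
          (fun t _ => hχm t) hs
      · refine HasMFDerivWithinAt.congr_of_eventuallyEq (f := η ∘ θ) ?_ (h.filter_mono nhdsWithin_le_nhds)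
          h.self_of_nhds
        rw [hLV, h0, zero_smul, zero_add, h.self_of_nhds]
        exact IsSolutionOn.comp_hasDerivWithinAt hη.equation (hθd s).hasDerivWithinAt
          (fun t _ => hθm t) hs
    · rw [hΓγ t ht]
      exact (hγX _ (hχm t)).1
    · rw [hΓη t ht, ← (hγX 1 (by simp)).1]
      exact (hηX _ (hθm t)).1
  choose! Γ hΓ hΓH hΓK using hline
  have hflow : ∀ x ∈ X, ∀ t ∈ Icc (0 : ℝ) 1, flow (hamVectorField om L) t x = Γ x t :=
    fun x hx t ht => (hΓ x hx).flow_eq_of_mem (hom.isC1Field hLs) ht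
  refine ⟨L, ⟨hLs, fun x hx => ⟨_, hΓ x hx⟩, fun t ht => ?_⟩, fun x hx => ?_⟩
  · rcases le_total t (1 / 2) with h | h
    · rw [image_congr fun x hx => (hflow x hx t ht).trans (hΓH x hx t (by linarith))]
      exact hHc.2 _ (hχm t)
    · rw [image_congr fun x hx => (hflow x hx t ht).trans (hΓK x hx t (by linarith)),
        ← image_image (flow (hamVectorField om K) (θ t)), hHc.2 1 (by simp)]
      exact hKc.2 _ (hθm t)
  · rw [hflow x hx 1 (by simp), hΓK x hx 1 (by norm_num), hθ1]

theorem exists_subgroup_image_eq_Ham (hom : IsSymplecticForm om) :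
    ∃ G : Subgroup (X ≃ₜ X),
      (fun (g : X ≃ₜ X) (x : X) => g x) '' (G : Set (X ≃ₜ X)) = Ham om X := by
  have hcont : ∀ φ ∈ Ham om X, Continuous φ := by
    rintro φ ⟨H, hH, hφ⟩
    rw [IsInducing.subtypeVal.continuous_iff]
    have h := (hH.2.continuousOn_flow (hom.isC1Field hH.1) (t := 1) (by simp)).domRestrict
    exact h.congr fun x => (hφ x).symm
  have hinv : ∀ φ ∈ Ham om X, ∃ ψ ∈ Ham om X, ∀ x, ψ (φ x) = x := by
    rintro φ ⟨H, hH, hφ⟩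
    obtain ⟨K, hK, hKH⟩ := exists_reverse_mem_compatibleHamiltonians hom hH
    have hmaps : ∀ x : X, flow (hamVectorField om K) 1 x ∈ X := fun x => by
      have := mem_image_of_mem (flow (hamVectorField om K) 1) x.2
      rwa [hK.2.2 1 (by simp)] at this
    refine ⟨fun x => ⟨_, hmaps x⟩, ⟨K, hK, fun x => rfl⟩, fun x => Subtype.ext ?_⟩
    change flow (hamVectorField om K) 1 (φ x) = x
    rw [hφ, hKH x x.2]
  refine ⟨{ carrier := {g | (g : X → X) ∈ Ham om X}
            one_mem' := ⟨0, (zero_mem_compatibleHamiltonians hom).1, fun x =>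
              ((zero_mem_compatibleHamiltonians (X := X) hom).2 x).symm⟩
            mul_mem' := ?_
            inv_mem' := ?_ }, ?_⟩
  · rintro f g ⟨K, hK, hf⟩ ⟨H, hH, hg⟩
    obtain ⟨L, hL, hLf⟩ := exists_concatenation_mem_compatibleHamiltonians hom hH hK
    refine ⟨L, hL, fun x => ?_⟩
    change (f (g x) : M) = _
    rw [hLf x x.2, ← hg, ← hf]
  · intro f hf
    obtain ⟨ψ, hψ, hψf⟩ := hinv f hf
    have : ((f⁻¹ : X ≃ₜ X) : X → X) = ψ := by
      ext1 x
      obtain ⟨y, rfl⟩ := f.surjective x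
      rw [hψf]
      exact f.symm_apply_apply y
    change ((f⁻¹ : X ≃ₜ X) : X → X) ∈ Ham om X
    rwa [this]
  · refine Subset.antisymm (by rintro φ ⟨g, hg, rfl⟩; exact hg) fun φ hφ => ?_
    obtain ⟨ψ, hψ, hψφ⟩ := hinv φ hφ
    obtain ⟨ρ, hρ, hρψ⟩ := hinv ψ hψ
    -- Only left inverses have been produced. The left inverse `ψ` itself has a left inverse `ρ`,
    -- which forces `ψ` to be two-sided.
    have hφψ : ∀ x, φ (ψ x) = x := fun x => by
      rw [← hρψ (φ (ψ x)), hψφ, hρψ]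
    exact ⟨⟨⟨φ, ψ, hψφ, hφψ⟩, hcont φ hφ, hcont ψ hψ⟩, hφ, rfl⟩

end Hamiltonians

/-! ### Vector fields and flows restricted to a submanifold -/

section Submanifolds

variable {E : Type*} [NormedAddCommGroup E] [NormedSpace ℝ E]
  {M : Type*} [TopologicalSpace M] [ChartedSpace E M]
  {F : Type*} [NormedAddCommGroup F] [NormedSpace ℝ F]
  {X : Set M} [ChartedSpace F X]

variable (E F) in
/-- The derivative of the inclusion of a subset with a smooth structure. -/
def inclDeriv (y : X) : TangentSpace 𝓘(ℝ, F) y →L[ℝ] TangentSpace 𝓘(ℝ, E) (y : M) :=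
  mfderiv 𝓘(ℝ, F) 𝓘(ℝ, E) (Subtype.val : X → M) y

theorem pullbackBilin_val_apply (om : TangentBilin E M) (y : X) (u w : TangentSpace 𝓘(ℝ, F) y) :
    pullbackBilin (F := F) (Subtype.val : X → M) om y u w =
      om y (inclDeriv E F y u) (inclDeriv E F y w) :=
  rfl

/-- The vector field `V` restricts to the vector field `W` on `X`, at times in `[0, 1]`. -/
def RestrictsTo (V : ℝ → ∀ x : M, TangentSpace 𝓘(ℝ, E) x)
    (W : ℝ → ∀ y : X, TangentSpace 𝓘(ℝ, F) y) : Prop :=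
  ∀ t ∈ Icc (0 : ℝ) 1, ∀ y : X, inclDeriv E F y (W t y) = V t y

theorem hasMFDerivAt_val (hι : ContMDiff 𝓘(ℝ, F) 𝓘(ℝ, E) ∞ (Subtype.val : X → M)) (y : X) :
    HasMFDerivAt 𝓘(ℝ, F) 𝓘(ℝ, E) (Subtype.val : X → M) y (inclDeriv E F y) :=
  (hι.mdifferentiableAt (by simp)).hasMFDerivAt

theorem IsFlowLine.congr {V : ℝ → ∀ x : M, TangentSpace 𝓘(ℝ, E) x} {t : ℝ} {x : M}
    {γ η : ℝ → M} (h : IsFlowLine V t x γ) (ht : 0 ≤ t) (hη : EqOn η γ (Icc 0 t)) :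
    IsFlowLine V t x η where
  smooth := h.smooth.congr hη
  initial := (hη ⟨le_rfl, ht⟩).trans h.initial
  equation := fun s hs => by
    have h1 := (h.equation s hs).congr_of_eventuallyEq
      (hη.eventuallyEq_of_mem self_mem_nhdsWithin) (hη hs)
    rw [hη hs]
    exact h1

theorem RestrictsTo.isFlowLine {V : ℝ → ∀ x : M, TangentSpace 𝓘(ℝ, E) x}
    {W : ℝ → ∀ y : X, TangentSpace 𝓘(ℝ, F) y} (h : RestrictsTo V W)
    (hι : ContMDiff 𝓘(ℝ, F) 𝓘(ℝ, E) ∞ (Subtype.val : X → M)) {t : ℝ} (ht : t ≤ 1) {y : X}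
    {γ : ℝ → X} (hγ : IsFlowLine W t y γ) : IsFlowLine V t (y : M) (fun s => (γ s : M)) where
  smooth := hι.comp_contMDiffOn hγ.smooth
  initial := congrArg Subtype.val hγ.initial
  equation := fun s hs => by
    refine ((hasMFDerivAt_val hι (γ s)).comp_hasMFDerivWithinAt s
      (hγ.equation s hs)).congr_mfderiv ?_
    rw [← h s ⟨hs.1, hs.2.trans ht⟩]
    ext
    change inclDeriv E F (γ s) ((1 : ℝ) • W s (γ s)) = (1 : ℝ) • inclDeriv E F (γ s) (W s (γ s))
    rw [map_smul]

theorem IsSmoothHam.restrict {H : ℝ → M → ℝ} (hH : IsSmoothHam (E := E) H)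
    (hι : ContMDiff 𝓘(ℝ, F) 𝓘(ℝ, E) ∞ (Subtype.val : X → M)) :
    IsSmoothHam (E := F) (fun t (y : X) => H t y) :=
  ContMDiffOn.comp (g := fun p : ℝ × M => H p.1 p.2) (f := fun p : ℝ × X => (p.1, (p.2 : M))) hH
    (contMDiff_fst.prodMk (hι.comp contMDiff_snd)).contMDiffOn fun _ hp => ⟨hp.1, mem_univ _⟩

theorem IsSmoothHam.scalarDeriv_restrict {H : ℝ → M → ℝ} (hH : IsSmoothHam (E := E) H)
    (hι : ContMDiff 𝓘(ℝ, F) 𝓘(ℝ, E) ∞ (Subtype.val : X → M)) {t : ℝ} (ht : t ∈ Icc (0 : ℝ) 1)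
    (y : X) (w : TangentSpace 𝓘(ℝ, F) y) :
    scalarDeriv (fun y : X => H t y) y w = scalarDeriv (H t) y (inclDeriv E F y w) := by
  have h := ((hH.hasMFDerivAt ht y).comp y (hasMFDerivAt_val hι y)).mfderiv
  exact DFunLike.congr_fun h w

variable [IsManifold 𝓘(ℝ, E) ∞ M] [T2Space M]

theorem RestrictsTo.flow_eq {V : ℝ → ∀ x : M, TangentSpace 𝓘(ℝ, E) x}
    {W : ℝ → ∀ y : X, TangentSpace 𝓘(ℝ, F) y} (h : RestrictsTo V W) (hV : IsC1Field V)
    (hι : ContMDiff 𝓘(ℝ, F) 𝓘(ℝ, E) ∞ (Subtype.val : X → M)) {t : ℝ} (ht : t ∈ Icc (0 : ℝ) 1)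
    {y : X} (hy : y ∈ flowDomain W t) : ((flow W t y : X) : M) = flow V t y := by
  have hy' : ∃ γ : ℝ → X, IsFlowLine W t y γ := hy
  rw [(h.isFlowLine hι ht.2 hy'.choose_spec).flow_eq hV ht, flow, dif_pos hy']

/-- The inclusion intertwines the two flows wherever the flow of `W` is defined. Completeness of `W`
on `[0, 1]` guarantees that no default value of `flow` enters the images. -/
theorem RestrictsTo.isCompatible_iff {V : ℝ → ∀ x : M, TangentSpace 𝓘(ℝ, E) x}
    {W : ℝ → ∀ y : X, TangentSpace 𝓘(ℝ, F) y} (h : RestrictsTo V W) (hV : IsC1Field V)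
    (hι : ContMDiff 𝓘(ℝ, F) 𝓘(ℝ, E) ∞ (Subtype.val : X → M)) (hW : univ ⊆ flowDomain W 1) :
    IsCompatible X V ↔ IsCompatible univ W := by
  have hdom : ∀ t ∈ Icc (0 : ℝ) 1, ∀ y : X, y ∈ flowDomain W t := fun t ht y =>
    (hW (mem_univ y)).imp fun γ hγ => hγ.mono ht.2
  have himg : ∀ t ∈ Icc (0 : ℝ) 1, flow V t '' X = Subtype.val '' (flow W t '' univ) := by
    intro t ht
    rw [image_image, image_congr fun y _ => h.flow_eq hV hι ht (hdom t ht y),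
      ← image_image (flow V t) Subtype.val, image_univ, Subtype.range_coe]
  have h1 : X ⊆ flowDomain V 1 := fun x hx => by
    obtain ⟨γ, hγ⟩ := hW (mem_univ ⟨x, hx⟩)
    exact ⟨_, h.isFlowLine hι le_rfl hγ⟩
  refine ⟨fun hc => ⟨hW, fun t ht => ?_⟩, fun hc => ⟨h1, fun t ht => ?_⟩⟩
  · refine Subtype.val_injective.image_injective ?_
    rw [← himg t ht, hc.2 t ht, image_univ, Subtype.range_coe]
  · rw [himg t ht, hc.2 t ht, image_univ, Subtype.range_coe]

end Submanifolds

/-! ### Tangency of compatible Hamiltonian fields to a symplectic submanifold -/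

section Retraction

variable {E : Type*} [NormedAddCommGroup E] [NormedSpace ℝ E]
  {M : Type*} [TopologicalSpace M] [ChartedSpace E M]
  {F : Type*} [NormedAddCommGroup F] [NormedSpace ℝ F]
  {X : Set M} [ChartedSpace F X]

/-- Near each of its points, an embedded submanifold is a smooth retract. -/
theorem exists_local_retraction
    (h : IsSmoothEmbedding 𝓘(ℝ, F) 𝓘(ℝ, E) ∞ (Subtype.val : X → M)) (x₀ : X) :
    ∃ U : Set M, IsOpen U ∧ (x₀ : M) ∈ U ∧ ∃ r : M → X,
      ContMDiffOn 𝓘(ℝ, E) 𝓘(ℝ, F) ∞ r U ∧ ∀ y : X, (y : M) ∈ U → r y = y := by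
  have hi := h.isImmersion.isImmersionAt x₀
  set d := hi.domChart with hd
  set c := hi.codChart with hc
  set e := hi.equiv with he
  -- This is where the embedding, not merely the immersion, is used: the chart domain in `X` is cut
  -- out by an open set of `M`, so distant sheets of `X` are kept away.
  obtain ⟨O, hO, hOd⟩ := h.isEmbedding.isInducing.isOpen_iff.1 d.open_source
  have hcs : ContMDiffOn 𝓘(ℝ, E) 𝓘(ℝ, E) ∞ c c.source :=
    contMDiffOn_of_mem_maximalAtlas hi.codChart_mem_maximalAtlas
  have hds : ContMDiffOn 𝓘(ℝ, F) 𝓘(ℝ, F) ∞ d.symm d.target :=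
    contMDiffOn_symm_of_mem_maximalAtlas hi.domChart_mem_maximalAtlas
  -- In the immersion normal form the inclusion is `u ↦ (u, 0)`; the retraction forgets the second
  -- component.
  set q : M → F := fun m => (e.symm (c m)).1 with hq
  have hqs : ContMDiffOn 𝓘(ℝ, E) 𝓘(ℝ, F) ∞ q c.source :=
    (contDiff_fst.comp e.symm.contDiff).contMDiff.comp_contMDiffOn hcs
  have hdq : ∀ y ∈ d.source, q y = d y := by
    intro y hy
    have h0 : d y ∈ (d.extend 𝓘(ℝ, F)).target := by
      simpa [OpenPartialHomeomorph.extend_target] using d.map_source hy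
    have h1 := hi.writtenInCharts h0
    simp only [Function.comp, OpenPartialHomeomorph.extend_coe, modelWithCornersSelf_coe, id_eq,
      OpenPartialHomeomorph.extend_coe_symm, modelWithCornersSelf_coe_symm, ← hd, ← hc, ← he,
      d.left_inv hy] at h1
    simp only [hq, h1, ContinuousLinearEquiv.symm_apply_apply]
  have hsrc : ∀ y : X, y ∈ d.source ↔ (y : M) ∈ O := fun y => by rw [← hOd]; rfl
  refine ⟨(c.source ∩ q ⁻¹' d.target) ∩ O, ?_, ⟨⟨hi.mem_codChart_source, ?_⟩, ?_⟩, d.symm ∘ q,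
    ?_, ?_⟩
  · exact (hqs.continuousOn.isOpen_inter_preimage c.open_source d.open_target).inter hO
  · change q x₀ ∈ d.target
    rw [hdq x₀ hi.mem_domChart_source]
    exact d.map_source hi.mem_domChart_source
  · exact (hsrc x₀).1 hi.mem_domChart_source
  · exact hds.comp (hqs.mono fun m hm => hm.1.1) fun m hm => hm.1.2
  · intro y hy
    have hyd := (hsrc y).2 hy.2
    rw [Function.comp, hdq y hyd, d.left_inv hyd]

/-- Locally the curve is its image in `M` followed by a smooth retraction onto `X`. -/
theorem contMDiffOn_of_contMDiffOn_val
    (h : IsSmoothEmbedding 𝓘(ℝ, F) 𝓘(ℝ, E) ∞ (Subtype.val : X → M)) {γ : ℝ → X} {S : Set ℝ}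
    (hγ : ContMDiffOn 𝓘(ℝ, ℝ) 𝓘(ℝ, E) ∞ (fun s => (γ s : M)) S) :
    ContMDiffOn 𝓘(ℝ, ℝ) 𝓘(ℝ, F) ∞ γ S := by
  intro s hs
  obtain ⟨U, hU, hsU, r, hr, hrX⟩ := exists_local_retraction h (γ s)
  refine (((hr _ hsU).contMDiffAt (hU.mem_nhds hsU)).comp_contMDiffWithinAt s
    (hγ s hs)).congr_of_eventuallyEq ?_ (hrX _ hsU).symm
  filter_upwards [(hγ s hs).continuousWithinAt.preimage_mem_nhdsWithin (hU.mem_nhds hsU)]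
    with τ hτ using (hrX _ hτ).symm

variable [IsManifold 𝓘(ℝ, F) ∞ X] [FiniteDimensional ℝ E]
  [FiniteDimensional ℝ F] {om : TangentBilin E M}

/-- Flow lines of a Hamiltonian vector field which stay in a symplectic submanifold are flow lines
of the Hamiltonian vector field of the restricted function. -/
theorem IsSymplecticSubmanifold.isFlowLine_restrict (hX : IsSymplecticSubmanifold F om X)
    (hom : IsNondegenerateForm om) {H : ℝ → M → ℝ} (hH : IsSmoothHam (E := E) H) {y : X}
    {γ : ℝ → X} (hγ : IsFlowLine (hamVectorField om H) 1 (y : M) (fun s => (γ s : M))) :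
    IsFlowLine (hamVectorField (pullbackBilin (F := F) (Subtype.val : X → M) om)
      (fun t (y : X) => H t y)) 1 y γ ∧ ∀ s ∈ Icc (0 : ℝ) 1,
      inclDeriv E F (γ s) (hamVectorField (pullbackBilin (F := F) (Subtype.val : X → M) om)
        (fun t (y : X) => H t y) s (γ s)) = hamVectorField om H s (γ s) := by
  have hι := hX.embedding.contMDiff
  have hsm := contMDiffOn_of_contMDiffOn_val hX.embedding hγ.smooth
  have key : ∀ s ∈ Icc (0 : ℝ) 1, ∃ u : TangentSpace 𝓘(ℝ, F) (γ s),
      HasMFDerivWithinAt 𝓘(ℝ, ℝ) 𝓘(ℝ, F) γ (Icc 0 1) s ((1 : ℝ →L[ℝ] ℝ).smulRight u) ∧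
      inclDeriv E F (γ s) u = hamVectorField om H s (γ s) ∧
      hamVectorField (pullbackBilin (F := F) (Subtype.val : X → M) om)
        (fun t (y : X) => H t y) s (γ s) = u := by
    intro s hs
    have h1 := ((hsm s hs).mdifferentiableWithinAt (by simp)).hasMFDerivWithinAt
    set D : ℝ →L[ℝ] TangentSpace 𝓘(ℝ, F) (γ s) :=
      mfderivWithin 𝓘(ℝ, ℝ) 𝓘(ℝ, F) γ (Icc 0 1) s with hD
    have hD1 : D = (1 : ℝ →L[ℝ] ℝ).smulRight (D 1) := by
      ext
      change D 1 = (1 : ℝ) • D 1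
      rw [one_smul]
    have hU : UniqueMDiffWithinAt 𝓘(ℝ, ℝ) (Icc (0 : ℝ) 1) s :=
      uniqueMDiffWithinAt_iff_uniqueDiffWithinAt.2 (uniqueDiffOn_Icc zero_lt_one s hs)
    -- Derivatives within `[0, 1]` are unique, also at the end points, so the velocity of `γ` in `X`
    -- is mapped by the inclusion to the Hamiltonian vector.
    have h2 := hU.eq ((hasMFDerivAt_val hι (γ s)).comp_hasMFDerivWithinAt s h1)
      (hγ.equation s hs)
    have h3 : inclDeriv E F (γ s) (D 1) = hamVectorField om H s (γ s) := by
      have h4 := DFunLike.congr_fun h2 (1 : ℝ)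
      refine Eq.trans h4 ?_
      change (1 : ℝ) • hamVectorField om H s (γ s) = _
      rw [one_smul]
    refine ⟨D 1, h1.congr_mfderiv hD1, h3, hX.nondegenerate.hamVectorField_eq fun w => ?_⟩
    rw [pullbackBilin_val_apply, h3, hom.hamVectorField_spec, hH.scalarDeriv_restrict hι hs]
  refine ⟨⟨hsm, Subtype.ext hγ.initial, fun s hs => ?_⟩, fun s hs => ?_⟩
  · obtain ⟨u, hu, -, h⟩ := key s hs
    rwa [h]
  · obtain ⟨u, -, hu, h⟩ := key s hs
    rwa [h]

variable [IsManifold 𝓘(ℝ, E) ∞ M] [T2Space M]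

/-- Surjectivity of the time-`t` flow on `X` is essential: it provides, for each time `t` and each
point of `X`, a flow line inside `X` through that point at that time. -/
theorem IsSymplecticSubmanifold.restrictsTo_of_isCompatible
    (hX : IsSymplecticSubmanifold F om X) (hom : IsSymplecticForm om) {H : ℝ → M → ℝ}
    (hH : H ∈ compatibleHamiltonians om X) :
    RestrictsTo (hamVectorField om H) (hamVectorField
        (pullbackBilin (F := F) (Subtype.val : X → M) om) (fun t (y : X) => H t y)) ∧
      univ ⊆ flowDomain (hamVectorField (pullbackBilin (F := F) (Subtype.val : X → M) om)
        (fun t (y : X) => H t y)) 1 := by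
  classical
  have hC := hom.isC1Field hH.1
  have hlift : ∀ y : X, ∃ γ : ℝ → X,
      IsFlowLine (hamVectorField om H) 1 (y : M) (fun s => (γ s : M)) := by
    intro y
    obtain ⟨γ, hγ, hγX⟩ := hH.2.exists_isFlowLine hC y.2
    -- The value `y` is a default for times outside `[0, 1]`, where the curve may leave `X`.
    refine ⟨fun s => if h : γ s ∈ X then ⟨γ s, h⟩ else y, hγ.congr zero_le_one fun s hs => ?_⟩
    simp only [dif_pos (hγX s hs).2]
  refine ⟨fun t ht y => ?_, fun y _ => ?_⟩
  · have hy : (y : M) ∈ flow (hamVectorField om H) t '' X := by rw [hH.2.2 t ht]; exact y.2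
    obtain ⟨x, hx, hxy⟩ := hy
    obtain ⟨γ, hγ⟩ := hlift ⟨x, hx⟩
    have hγt : γ t = y := Subtype.ext ((hγ.flow_eq_of_mem hC ht).symm.trans hxy)
    have := (hX.isFlowLine_restrict hom.nondegenerate hH.1 hγ).2 t ht
    rwa [hγt] at this
  · obtain ⟨γ, hγ⟩ := hlift y
    exact ⟨γ, (hX.isFlowLine_restrict hom.nondegenerate hH.1 hγ).1⟩

end Retraction

/-! ### Gluing functions with prescribed first-order data along a subset -/

section Gluing

theorem hasMFDerivAt_finsetSum {E : Type*} [NormedAddCommGroup E] [NormedSpace ℝ E]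
    {M : Type*} [TopologicalSpace M] [ChartedSpace E M] {ι : Type*} (s : Finset ι)
    {f : ι → M → ℝ} {x : M} {f' : ι → TangentSpace 𝓘(ℝ, E) x →L[ℝ] ℝ}
    (h : ∀ i ∈ s, HasMFDerivAt 𝓘(ℝ, E) 𝓘(ℝ, ℝ) (f i) x (f' i)) :
    HasMFDerivAt 𝓘(ℝ, E) 𝓘(ℝ, ℝ) (∑ i ∈ s, f i) x (∑ i ∈ s, f' i) := by
  classical
  induction s using Finset.induction_on with
  | empty => exact hasMFDerivAt_const (I := 𝓘(ℝ, E)) (I' := 𝓘(ℝ, ℝ)) (0 : ℝ) x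
  | insert i s hi ih =>
    have h1 := (h i (Finset.mem_insert_self i s)).add
      (ih fun j hj => h j (Finset.mem_insert_of_mem hj))
    have h2 : ∑ j ∈ insert i s, f' j = f' i + ∑ j ∈ s, f' j := Finset.sum_insert hi
    rw [Finset.sum_insert hi]
    exact h1.congr_mfderiv h2.symm

variable {E : Type*} [NormedAddCommGroup E] [NormedSpace ℝ E] [FiniteDimensional ℝ E]
  {M : Type*} [TopologicalSpace M] [ChartedSpace E M] [IsManifold 𝓘(ℝ, E) ∞ M]
  [T2Space M] [SecondCountableTopology M]

/-- Time-dependent functions with prescribed values and differentials at the points of `X` can be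
glued. -/
theorem exists_isSmoothHam_of_local {X : Set M} (c : ℝ → M → ℝ)
    (α : ℝ → ∀ x : M, TangentSpace 𝓘(ℝ, E) x →L[ℝ] ℝ)
    (hloc : ∀ x₀ : M, ∃ U : Set M, IsOpen U ∧ x₀ ∈ U ∧ ∃ G : ℝ → M → ℝ,
      ContMDiffOn (𝓘(ℝ, ℝ).prod 𝓘(ℝ, E)) 𝓘(ℝ, ℝ) ∞ (fun p : ℝ × M => G p.1 p.2)
        (Icc 0 1 ×ˢ U) ∧
      ∀ t ∈ Icc (0 : ℝ) 1, ∀ x ∈ X, x ∈ U → G t x = c t x ∧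
        HasMFDerivAt 𝓘(ℝ, E) 𝓘(ℝ, ℝ) (G t) x (α t x)) :
    ∃ H : ℝ → M → ℝ, IsSmoothHam (E := E) H ∧ ∀ t ∈ Icc (0 : ℝ) 1, ∀ x ∈ X, H t x = c t x ∧
      HasMFDerivAt 𝓘(ℝ, E) 𝓘(ℝ, ℝ) (H t) x (α t x) := by
  have : LocallyCompactSpace M := Manifold.locallyCompact_of_finiteDimensional 𝓘(ℝ, E)
  have : SigmaCompactSpace M := sigmaCompactSpace_of_locallyCompact_secondCountable
  choose U hU hxU G hG hGX using hloc
  obtain ⟨ρ, hρ⟩ := SmoothPartitionOfUnity.exists_isSubordinate 𝓘(ℝ, E) isClosed_univ U hU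
    fun x _ => mem_iUnion.2 ⟨x, hxU x⟩
  have hρs : ∀ i, ContMDiff 𝓘(ℝ, E) 𝓘(ℝ, ℝ) ∞ (ρ i) := fun i => (ρ i).contMDiff
  set H : ℝ → M → ℝ := fun t x => ∑ᶠ i, ρ i x * G i t x with hH
  have hev : ∀ x, ∀ᶠ y in 𝓝 x, ∀ t, H t y = ∑ i ∈ ρ.fintsupport x, ρ i y * G i t y := by
    intro x
    filter_upwards [ρ.eventually_finsupport_subset x] with y hy t
    refine finsum_eq_sum_of_support_subset _ fun i hi => hy ?_
    rw [SmoothPartitionOfUnity.mem_finsupport]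
    exact left_ne_zero_of_mul hi
  have hfin : ∀ x, ∀ i ∈ ρ.fintsupport x, x ∈ U i := fun x i hi =>
    hρ i ((ρ.mem_fintsupport_iff x i).1 hi)
  have hHs : IsSmoothHam (E := E) H := by
    rintro ⟨t, x⟩ ⟨ht, -⟩
    have h1 : ContMDiffWithinAt (𝓘(ℝ, ℝ).prod 𝓘(ℝ, E)) 𝓘(ℝ, ℝ) ∞
        (fun p : ℝ × M => ∑ i ∈ ρ.fintsupport x, ρ i p.2 * G i p.1 p.2) (Icc 0 1 ×ˢ univ)
        (t, x) := by
      refine contMDiffWithinAt_finsetSum fun i hi => ?_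
      have h2 : Icc (0 : ℝ) 1 ×ˢ U i ∈ 𝓝[Icc 0 1 ×ˢ univ] (t, x) := by
        rw [nhdsWithin_prod_eq]
        exact Filter.prod_mem_prod self_mem_nhdsWithin
          (mem_nhdsWithin_of_mem_nhds ((hU i).mem_nhds (hfin x i hi)))
      have h3 : ContMDiff (𝓘(ℝ, ℝ).prod 𝓘(ℝ, E)) 𝓘(ℝ, ℝ) ∞ fun p : ℝ × M => ρ i p.2 :=
        (hρs i).comp contMDiff_snd
      exact h3.contMDiffAt.contMDiffWithinAt.mul
        ((hG i (t, x) ⟨ht, hfin x i hi⟩).mono_of_mem_nhdsWithin h2)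
    refine h1.congr_of_eventuallyEq ?_ ((hev x).self_of_nhds t)
    have h3 : ∀ᶠ p : ℝ × M in 𝓝 (t, x), ∀ t, H t p.2 =
        ∑ i ∈ ρ.fintsupport x, ρ i p.2 * G i t p.2 :=
      (continuous_snd.tendsto (t, x)).eventually (hev x)
    filter_upwards [mem_nhdsWithin_of_mem_nhds h3] with p hp using hp p.1
  refine ⟨H, hHs, fun t ht x hx => ?_⟩
  have hval : ∀ i ∈ ρ.fintsupport x, G i t x = c t x := fun i hi =>
    (hGX i t ht x hx (hfin x i hi)).1
  have hone : ∀ᶠ y in 𝓝 x, ∑ i ∈ ρ.fintsupport x, ρ i y = 1 := by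
    filter_upwards [ρ.eventually_finsupport_subset x] with y hy
    exact ρ.sum_finsupport' y (mem_univ y) hy
  refine ⟨?_, ?_⟩
  · rw [(hev x).self_of_nhds t, Finset.sum_congr rfl fun i hi => by rw [hval i hi],
      ← Finset.sum_mul, hone.self_of_nhds, one_mul]
  have hρd : ∀ i, HasMFDerivAt 𝓘(ℝ, E) 𝓘(ℝ, ℝ) (ρ i) x (scalarDeriv (ρ i) x) := fun i =>
    ((hρs i).mdifferentiableAt (by simp)).hasMFDerivAt
  -- The cutoffs sum to the constant `1` near `x`, so their differentials cancel; as all `G i` share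
  -- the value `c t x`, only the average of equal differentials `α t x` remains.
  have hsum : ∑ i ∈ ρ.fintsupport x, scalarDeriv (ρ i) x =
      (0 : TangentSpace 𝓘(ℝ, E) x →L[ℝ] ℝ) := by
    have h1 : HasMFDerivAt 𝓘(ℝ, E) 𝓘(ℝ, ℝ) (∑ i ∈ ρ.fintsupport x, (ρ i : M → ℝ)) x
        (∑ i ∈ ρ.fintsupport x, scalarDeriv (ρ i) x) :=
      hasMFDerivAt_finsetSum _ fun i _ => hρd i
    have h2 := (hasMFDerivAt_const (I := 𝓘(ℝ, E)) (I' := 𝓘(ℝ, ℝ)) (1 : ℝ)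
      x).congr_of_eventuallyEq (f₁ := ∑ i ∈ ρ.fintsupport x, (ρ i : M → ℝ)) (by
        filter_upwards [hone] with y hy
        rw [Finset.sum_apply, hy])
    exact hasMFDerivAt_unique h1 h2
  have h1 : HasMFDerivAt 𝓘(ℝ, E) 𝓘(ℝ, ℝ)
      (∑ i ∈ ρ.fintsupport x, ((ρ i : M → ℝ) * G i t)) x
      (∑ i ∈ ρ.fintsupport x, (ρ i x • α t x + c t x • scalarDeriv (ρ i) x)) := by
    refine hasMFDerivAt_finsetSum _ fun i hi => ?_
    have h2 := (hρd i).mul (hGX i t ht x hx (hfin x i hi)).2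
    rwa [hval i hi] at h2
  have h2 : HasMFDerivAt 𝓘(ℝ, E) 𝓘(ℝ, ℝ) (H t) x
      (∑ i ∈ ρ.fintsupport x, (ρ i x • α t x + c t x • scalarDeriv (ρ i) x)) := by
    refine h1.congr_of_eventuallyEq (f₁ := H t) ?_
    filter_upwards [hev x] with y hy
    rw [hy t, Finset.sum_apply]
    rfl
  have h3 : ∑ i ∈ ρ.fintsupport x, (ρ i x • α t x + c t x • scalarDeriv (ρ i) x) = α t x := by
    rw [Finset.sum_add_distrib, ← Finset.sum_smul, ← Finset.smul_sum, hsum, smul_zero, add_zero,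
      hone.self_of_nhds, one_smul]
  exact h2.congr_mfderiv h3

end Gluing

/-! ### Extending Hamiltonians from a symplectic submanifold -/

section Extension

variable {E : Type*} [NormedAddCommGroup E] [NormedSpace ℝ E]
  {M : Type*} [TopologicalSpace M] [ChartedSpace E M]
  {F : Type*} [NormedAddCommGroup F] [NormedSpace ℝ F]
  {X : Set M} [ChartedSpace F X]

variable (E F) in
/-- The inclusion of `X` in the preferred charts at `x₀`. -/
def coordIncl (x₀ : X) (z : F) : E :=
  extChartAt 𝓘(ℝ, E) (x₀ : M) ((extChartAt 𝓘(ℝ, F) x₀).symm z : X)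

variable (E F) in
/-- The points of the chart of `X` at `x₀` which lie in the chart of `M` at `x₀`. -/
def coordInclDomain (x₀ : X) : Set F :=
  (extChartAt 𝓘(ℝ, F) x₀).target ∩ (extChartAt 𝓘(ℝ, F) x₀).symm ⁻¹'
    (Subtype.val ⁻¹' (extChartAt 𝓘(ℝ, E) (x₀ : M)).source)

theorem isOpen_coordInclDomain (x₀ : X) : IsOpen (coordInclDomain E F x₀) :=
  (continuousOn_extChartAt_symm x₀).isOpen_inter_preimage (isOpen_extChartAt_target x₀)
    ((isOpen_extChartAt_source (x₀ : M)).preimage continuous_subtype_val)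

variable [IsManifold 𝓘(ℝ, E) ∞ M] [IsManifold 𝓘(ℝ, F) ∞ X]

theorem contDiffOn_coordIncl (hι : ContMDiff 𝓘(ℝ, F) 𝓘(ℝ, E) ∞ (Subtype.val : X → M)) (x₀ : X) :
    ContDiffOn ℝ ∞ (coordIncl E F x₀) (coordInclDomain E F x₀) := by
  rw [← contMDiffOn_iff_contDiffOn]
  exact contMDiffOn_extChartAt.comp (hι.comp_contMDiffOn
    ((contMDiffOn_extChartAt_symm x₀).mono inter_subset_left)) fun z hz => by
      rw [← extChartAt_source 𝓘(ℝ, E)]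
      exact hz.2

theorem fderiv_coordIncl (hι : ContMDiff 𝓘(ℝ, F) 𝓘(ℝ, E) ∞ (Subtype.val : X → M)) {x₀ y : X}
    (hy : y ∈ (extChartAt 𝓘(ℝ, F) x₀).source)
    (hy' : (y : M) ∈ (extChartAt 𝓘(ℝ, E) (x₀ : M)).source) (w : TangentSpace 𝓘(ℝ, F) y) :
    fderiv ℝ (coordIncl E F x₀) (extChartAt 𝓘(ℝ, F) x₀ y) (chartDeriv x₀ y w) =
      chartDeriv (x₀ : M) (y : M) (inclDeriv E F y w) := by
  have hz : extChartAt 𝓘(ℝ, F) x₀ y ∈ coordInclDomain E F x₀ :=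
    ⟨(extChartAt 𝓘(ℝ, F) x₀).map_source hy, by
      simpa only [mem_preimage, (extChartAt 𝓘(ℝ, F) x₀).left_inv hy] using hy'⟩
  have h1 : HasFDerivAt (coordIncl E F x₀)
      (fderiv ℝ (coordIncl E F x₀) (extChartAt 𝓘(ℝ, F) x₀ y)) (extChartAt 𝓘(ℝ, F) x₀ y) :=
    (((contDiffOn_coordIncl hι x₀).contDiffAt ((isOpen_coordInclDomain x₀).mem_nhds
      hz)).differentiableAt (by simp)).hasFDerivAt
  have h2 := (h1.hasMFDerivAt).comp y (hasMFDerivAt_extChartAt_of_mem hy)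
  have h3 := (hasMFDerivAt_extChartAt_of_mem hy').comp y (hasMFDerivAt_val hι y)
  have h4 := h3.congr_of_eventuallyEq
    (f₁ := coordIncl E F x₀ ∘ extChartAt 𝓘(ℝ, F) x₀) (by
      filter_upwards [(isOpen_extChartAt_source x₀).mem_nhds hy] with y' hy'
      simp only [Function.comp, coordIncl, (extChartAt 𝓘(ℝ, F) x₀).left_inv hy'])
  exact DFunLike.congr_fun (hasMFDerivAt_unique h2 h4) w

theorem coordForm_extChartAt (om : TangentBilin E M) {x₀ x : M}
    (hx : x ∈ (extChartAt 𝓘(ℝ, E) x₀).source) (v w : TangentSpace 𝓘(ℝ, E) x) :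
    coordForm om x₀ (extChartAt 𝓘(ℝ, E) x₀ x) (chartDeriv x₀ x v) (chartDeriv x₀ x w) =
      om x v w := by
  obtain ⟨y, hy, rfl⟩ : ∃ y ∈ (extChartAt 𝓘(ℝ, E) x₀).target,
      (extChartAt 𝓘(ℝ, E) x₀).symm y = x :=
    ⟨_, (extChartAt 𝓘(ℝ, E) x₀).map_source hx, (extChartAt 𝓘(ℝ, E) x₀).left_inv hx⟩
  rw [(extChartAt 𝓘(ℝ, E) x₀).right_inv hy, coordForm_apply, chartSymmDeriv_chartDeriv hy,
    chartSymmDeriv_chartDeriv hy]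

theorem coordForm_pullbackBilin_val (om : TangentBilin E M)
    (hι : ContMDiff 𝓘(ℝ, F) 𝓘(ℝ, E) ∞ (Subtype.val : X → M)) {x₀ : X} {z : F}
    (hz : z ∈ coordInclDomain E F x₀) (u w : F) :
    coordForm (pullbackBilin (F := F) (Subtype.val : X → M) om) x₀ z u w =
      coordForm om (x₀ : M) (coordIncl E F x₀ z) (fderiv ℝ (coordIncl E F x₀) z u)
        (fderiv ℝ (coordIncl E F x₀) z w) := by
  have hy := (extChartAt 𝓘(ℝ, F) x₀).map_target hz.1
  have key : ∀ u : F, fderiv ℝ (coordIncl E F x₀) z u =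
      chartDeriv (x₀ : M) (((extChartAt 𝓘(ℝ, F) x₀).symm z : X) : M)
        (inclDeriv E F ((extChartAt 𝓘(ℝ, F) x₀).symm z) (chartSymmDeriv x₀ z u)) := by
    intro u
    have := fderiv_coordIncl hι hy hz.2 (chartSymmDeriv x₀ z u)
    rwa [(extChartAt 𝓘(ℝ, F) x₀).right_inv hz.1, chartDeriv_chartSymmDeriv hz.1] at this
  rw [key, key, coordIncl, coordForm_extChartAt om hz.2]
  rfl

variable [FiniteDimensional ℝ E] [FiniteDimensional ℝ F] {om : TangentBilin E M}

/-- Smoothness in these coordinates is all that the extension needs to know about the pulled back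
form; its closedness plays no role. -/
theorem contDiffOn_coordForm_pullbackBilin_val (hom : IsSymplecticForm om)
    (hι : ContMDiff 𝓘(ℝ, F) 𝓘(ℝ, E) ∞ (Subtype.val : X → M)) (x₀ : X) :
    ContDiffOn ℝ ∞ (coordForm (pullbackBilin (F := F) (Subtype.val : X → M) om) x₀)
      (coordInclDomain E F x₀) := by
  have h1 := contDiffOn_coordIncl hι x₀
  have h2 : ContDiffOn ℝ ∞ (fun z => fderiv ℝ (coordIncl E F x₀) z) (coordInclDomain E F x₀) :=
    h1.fderiv_of_isOpen (isOpen_coordInclDomain x₀) (by simp)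
  have h3 : ContDiffOn ℝ ∞ (fun z => coordForm om (x₀ : M) (coordIncl E F x₀ z))
      (coordInclDomain E F x₀) :=
    (hom.contDiffOn_coordForm (x₀ : M)).comp h1 fun z hz =>
      (extChartAt 𝓘(ℝ, E) (x₀ : M)).map_source hz.2
  refine contDiffOn_clm_apply.2 fun u => contDiffOn_clm_apply.2 fun w => ?_
  exact ((h3.clm_apply (h2.clm_apply contDiffOn_const)).clm_apply
    (h2.clm_apply contDiffOn_const)).congr fun z hz => coordForm_pullbackBilin_val om hι hz u w

/-- The covector field along `X` which the differential of an extension of `h` has to be in order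
for the Hamiltonian vector field of the extension to restrict to that of `h`. -/
def extensionCovector (om : TangentBilin E M) (h : ℝ → X → ℝ) (t : ℝ) (y : X) :
    TangentSpace 𝓘(ℝ, E) (y : M) →L[ℝ] ℝ :=
  om y (inclDeriv E F y
    (hamVectorField (pullbackBilin (F := F) (Subtype.val : X → M) om) h t y))

/-- The extension is a first-order Taylor expansion in the normal direction: with `z` the coordinate
of the retraction `r m`, it is the value of `h` at `z` plus the prescribed covector applied to the
chart displacement of `m` from the point of `X` over `z`. -/
theorem IsSymplecticSubmanifold.exists_local_extension (hX : IsSymplecticSubmanifold F om X)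
    (hom : IsSymplecticForm om) {h : ℝ → X → ℝ} (hh : IsSmoothHam (E := F) h) (x₀ : X) :
    ∃ U : Set M, IsOpen U ∧ (x₀ : M) ∈ U ∧ ∃ G : ℝ → M → ℝ,
      ContMDiffOn (𝓘(ℝ, ℝ).prod 𝓘(ℝ, E)) 𝓘(ℝ, ℝ) ∞ (fun p : ℝ × M => G p.1 p.2)
        (Icc 0 1 ×ˢ U) ∧
      ∀ t ∈ Icc (0 : ℝ) 1, ∀ y : X, (y : M) ∈ U → G t y = h t y ∧
        HasMFDerivAt 𝓘(ℝ, E) 𝓘(ℝ, ℝ) (G t) (y : M) (extensionCovector (F := F) om h t y) := by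
  have hι := hX.embedding.contMDiff
  obtain ⟨U, hU, hx₀U, r, hr, hrX⟩ := exists_local_retraction hX.embedding x₀
  set χ := extChartAt 𝓘(ℝ, F) x₀ with hχ
  set ψ := extChartAt 𝓘(ℝ, E) (x₀ : M) with hψ
  set O := coordInclDomain E F x₀ with hO
  set f := coordIncl E F x₀ with hf
  have hOo : IsOpen O := isOpen_coordInclDomain x₀
  have hfs : ContDiffOn ℝ ∞ f O := contDiffOn_coordIncl hι x₀
  set v : ℝ → F → F := coordField
    (hamVectorField (pullbackBilin (F := F) (Subtype.val : X → M) om) h) x₀ with hv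
  have hvs : ContDiffOn ℝ ∞ (fun p : ℝ × F => v p.1 p.2) (Icc 0 1 ×ˢ O) :=
    hX.nondegenerate.contDiffOn_coordField hh hOo inter_subset_left
      (contDiffOn_coordForm_pullbackBilin_val hom hι x₀)
  set β : ℝ → F → E →L[ℝ] ℝ := fun t z =>
    coordForm om (x₀ : M) (f z) (fderiv ℝ f z (v t z)) with hβ
  have hβs : ContDiffOn ℝ ∞ (fun p : ℝ × F => β p.1 p.2) (Icc 0 1 ×ˢ O) := by
    have h1 : ContDiffOn ℝ ∞ (fun z => coordForm om (x₀ : M) (f z)) O :=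
      (hom.contDiffOn_coordForm (x₀ : M)).comp hfs fun z hz => ψ.map_source hz.2
    have h2 : ContDiffOn ℝ ∞ (fun z => fderiv ℝ f z) O := hfs.fderiv_of_isOpen hOo (by simp)
    have h3 : MapsTo (Prod.snd : ℝ × F → F) (Icc 0 1 ×ˢ O) O := fun p hp => hp.2
    exact (h1.comp contDiff_snd.contDiffOn h3).clm_apply
      ((h2.comp contDiff_snd.contDiffOn h3).clm_apply hvs)
  set ĥ : ℝ → F → ℝ := fun t z => h t (χ.symm z) with hĥ
  have hĥs : ContDiffOn ℝ ∞ (fun p : ℝ × F => ĥ p.1 p.2) (Icc 0 1 ×ˢ O) :=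
    (hh.contDiffOn_coord x₀).mono (prod_mono le_rfl inter_subset_left)
  set k : ℝ → F × E → ℝ := fun t q => ĥ t q.1 + β t q.1 (q.2 - f q.1) with hk
  have hks : ContDiffOn ℝ ∞ (fun p : ℝ × (F × E) => k p.1 p.2) (Icc 0 1 ×ˢ (O ×ˢ univ)) := by
    have hp : ContDiffOn ℝ ∞ (fun p : ℝ × (F × E) => (p.1, p.2.1)) (Icc 0 1 ×ˢ (O ×ˢ univ)) := by
      fun_prop
    have hm : MapsTo (fun p : ℝ × (F × E) => (p.1, p.2.1)) (Icc 0 1 ×ˢ (O ×ˢ univ))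
        (Icc 0 1 ×ˢ O) := fun p hp => ⟨hp.1, hp.2.1⟩
    refine (hĥs.comp hp hm).add ((hβs.comp hp hm).clm_apply (ContDiffOn.sub (by fun_prop) ?_))
    exact hfs.comp (f := fun p : ℝ × (F × E) => p.2.1) (by fun_prop) fun p hp => hp.2.1
  -- On the graph of `f` the displacement vanishes, so the derivative of `β` contributes nothing.
  -- The two remaining terms in the `F` direction, `dĥ` and `-β ∘ df`, cancel by the defining
  -- equation of the Hamiltonian field on `X`.
  have hkd : ∀ t ∈ Icc (0 : ℝ) 1, ∀ z ∈ O,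
      HasFDerivAt (k t) ((β t z).comp (ContinuousLinearMap.snd ℝ F E)) (z, f z) := by
    intro t ht z hz
    have hpt : ContDiffOn ℝ ∞ (fun z : F => (t, z)) O := by fun_prop
    have hmt : MapsTo (fun z : F => (t, z)) O (Icc (0 : ℝ) 1 ×ˢ O) := fun z hz => ⟨ht, hz⟩
    have hfst : HasFDerivAt (Prod.fst : F × E → F) (ContinuousLinearMap.fst ℝ F E) (z, f z) :=
      hasFDerivAt_fst
    have d1 : HasFDerivAt (ĥ t) (fderiv ℝ (ĥ t) z) z :=
      (((hĥs.comp hpt hmt).contDiffAt (hOo.mem_nhds hz)).differentiableAt (by simp)).hasFDerivAt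
    have d2 : HasFDerivAt (β t) (fderiv ℝ (β t) z) z :=
      (((hβs.comp hpt hmt).contDiffAt (hOo.mem_nhds hz)).differentiableAt (by simp)).hasFDerivAt
    have d3 : HasFDerivAt f (fderiv ℝ f z) z :=
      ((hfs.contDiffAt (hOo.mem_nhds hz)).differentiableAt (by simp)).hasFDerivAt
    have d1' := HasFDerivAt.comp (z, f z) (g := ĥ t) d1 hfst
    have d2' := HasFDerivAt.comp (z, f z) (g := β t) d2 hfst
    have d3' := HasFDerivAt.comp (z, f z) (g := f) d3 hfst
    refine (d1'.add (d2'.clm_apply (hasFDerivAt_snd.sub d3'))).congr_fderiv ?_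
    have h1 : ∀ u : F, fderiv ℝ (ĥ t) z u = β t z (fderiv ℝ f z u) := fun u => by
      rw [hβ, ← coordForm_pullbackBilin_val om hι hz]
      exact (DFunLike.congr_fun (hX.nondegenerate.coordForm_coordField hh ht hz.1) u).symm
    ext u <;> simp [h1]
  set q : M → F × E := fun m => (χ (r m), ψ m) with hq
  set W : Set M := (U ∩ r ⁻¹' (χ.source ∩ Subtype.val ⁻¹' ψ.source)) ∩ ψ.source with hW
  have hψo : IsOpen ψ.source := isOpen_extChartAt_source (x₀ : M)
  have hWo : IsOpen W := (hr.continuousOn.isOpen_inter_preimage hU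
    ((isOpen_extChartAt_source x₀).inter (hψo.preimage continuous_subtype_val))).inter hψo
  have hqs : ContMDiffOn 𝓘(ℝ, E) 𝓘(ℝ, F × E) ∞ q W := by
    refine ContMDiffOn.prodMk_space (contMDiffOn_extChartAt.comp
      (hr.mono fun m hm => hm.1.1) fun m hm => ?_) (contMDiffOn_extChartAt.mono fun m hm => ?_)
    · rw [← extChartAt_source 𝓘(ℝ, F)]; exact hm.1.2.1
    · rw [← extChartAt_source 𝓘(ℝ, E)]; exact hm.2
  have hqO : ∀ m ∈ W, (q m).1 ∈ O := fun m hm =>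
    ⟨χ.map_source hm.1.2.1, by
      simp only [hq, mem_preimage, ← hχ, χ.left_inv hm.1.2.1]; exact hm.1.2.2⟩
  refine ⟨W, hWo, ⟨⟨hx₀U, ?_⟩, mem_extChartAt_source _⟩, fun t m => k t (q m), ?_,
    fun t ht y hy => ?_⟩
  · rw [mem_preimage, hrX x₀ hx₀U]
    exact ⟨mem_extChartAt_source _, mem_extChartAt_source _⟩
  · refine hks.contMDiffOn.comp (f := fun p : ℝ × M => (p.1, q p.2))
      (contMDiffOn_fst.prodMk_space (hqs.comp contMDiffOn_snd fun p hp => hp.2))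
      fun p hp => ⟨hp.1, hqO _ hp.2, mem_univ _⟩
  · have hry : r y = y := hrX y hy.1.1
    have hyχ : y ∈ χ.source := by have := hy.1.2.1; rwa [hry] at this
    have hyψ : (y : M) ∈ ψ.source := hy.2
    have hfy : f (χ y) = ψ y := by simp only [hf, coordIncl, ← hχ, ← hψ, χ.left_inv hyχ]
    have hqy : q y = (χ y, f (χ y)) := by simp only [hq, hry, hfy]
    have hyO : χ y ∈ O := by have := hqO y hy; rwa [hqy] at this
    refine ⟨?_, ?_⟩
    · simp only [hqy, hk, hĥ, sub_self, map_zero, add_zero, χ.left_inv hyχ]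
    have hqd := ((hqs.contMDiffAt (hWo.mem_nhds hy)).mdifferentiableAt (by simp)).hasMFDerivAt
    set D : TangentSpace 𝓘(ℝ, E) (y : M) →L[ℝ] F × E :=
      mfderiv 𝓘(ℝ, E) 𝓘(ℝ, F × E) q y with hD
    have hk' : HasFDerivAt (k t) ((β t (χ y)).comp (ContinuousLinearMap.snd ℝ F E)) (q y) := by
      rw [hqy]; exact hkd t ht _ hyO
    refine (hk'.hasMFDerivAt.comp (y : M) hqd).congr_mfderiv ?_
    -- Only the `E` component of the derivative of `q` survives, so the derivative of the retraction
    -- drops out.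
    have hDψ : (ContinuousLinearMap.snd ℝ F E).comp D = chartDeriv (x₀ : M) (y : M) :=
      hasMFDerivAt_unique ((ContinuousLinearMap.snd ℝ F E).hasFDerivAt.hasMFDerivAt.comp
        (y : M) hqd) (hasMFDerivAt_extChartAt_of_mem hyψ)
    ext w
    change β t (χ y) (((ContinuousLinearMap.snd ℝ F E).comp D) w) = _
    rw [hDψ, hβ]
    simp only
    rw [hv, coordField_extChartAt _ hyχ, fderiv_coordIncl hι hyχ hyψ, hfy]
    exact coordForm_extChartAt om hyψ _ _

variable [T2Space M] [SecondCountableTopology M]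

/-- Every time-dependent function on a closed symplectic submanifold extends to the ambient manifold
in such a way that its Hamiltonian vector field extends, too. -/
theorem IsSymplecticSubmanifold.exists_extension (hX : IsSymplecticSubmanifold F om X)
    (hom : IsSymplecticForm om) (hcl : IsClosed X) {h : ℝ → X → ℝ}
    (hh : IsSmoothHam (E := F) h) :
    ∃ H : ℝ → M → ℝ, IsSmoothHam (E := E) H ∧ RestrictsTo (hamVectorField om H)
      (hamVectorField (pullbackBilin (F := F) (Subtype.val : X → M) om) h) := by
  classical
  obtain ⟨H, hH, hHX⟩ := exists_isSmoothHam_of_local (X := X)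
    (fun t x => if hx : x ∈ X then h t ⟨x, hx⟩ else 0)
    (fun t x => if hx : x ∈ X then extensionCovector (F := F) om h t ⟨x, hx⟩ else 0) (by
      intro x₀
      by_cases hx₀ : x₀ ∈ X
      · obtain ⟨U, hU, hxU, G, hG, hGX⟩ := hX.exists_local_extension hom hh ⟨x₀, hx₀⟩
        refine ⟨U, hU, hxU, G, hG, fun t ht x hx hxU => ?_⟩
        simp only [dif_pos hx]
        exact hGX t ht ⟨x, hx⟩ hxU
      -- Closedness of `X` enters here: off `X` there are no conditions, and the zero function
      -- serves on the open complement.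
      · exact ⟨Xᶜ, hcl.isOpen_compl, hx₀, 0, contMDiffOn_const,
          fun t _ x hx hxc => absurd hx hxc⟩)
  refine ⟨H, hH, fun t ht y => (hom.nondegenerate.hamVectorField_eq fun w => ?_).symm⟩
  have h1 := (hHX t ht y y.2).2.mfderiv
  rw [dif_pos y.2] at h1
  exact (DFunLike.congr_fun h1 w).symm

/-- The intrinsic group consists of self-maps of `univ : Set X`, which the conjugation by
`Equiv.Set.univ X` identifies with self-maps of `X`. -/
theorem IsSymplecticSubmanifold.Ham_eq (hX : IsSymplecticSubmanifold F om X)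
    (hom : IsSymplecticForm om) (hcl : IsClosed X) :
    Ham om X = (Equiv.Set.univ X).arrowCongr (Equiv.Set.univ X) ''
      Ham (pullbackBilin (F := F) (Subtype.val : X → M) om) (univ : Set X) := by
  have hι := hX.embedding.contMDiff
  refine Subset.antisymm ?_ ?_
  · rintro φ ⟨H, hH, hφ⟩
    obtain ⟨hres, hdom⟩ := hX.restrictsTo_of_isCompatible hom hH
    have hC := hom.isC1Field hH.1
    refine ⟨(Equiv.Set.univ X).symm ∘ φ ∘ Equiv.Set.univ X, ⟨fun t (y : X) => H t y,
      ⟨IsSmoothHam.restrict hH.1 hι, (hres.isCompatible_iff hC hι hdom).1 hH.2⟩, fun y => ?_⟩, ?_⟩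
    · refine Subtype.ext ?_
      rw [hres.flow_eq hC hι (by simp) (hdom (mem_univ _))]
      exact hφ y
    · ext x
      simp [Equiv.arrowCongr]
  · rintro _ ⟨φ, ⟨h, hh, hφ⟩, rfl⟩
    obtain ⟨H, hH, hres⟩ := hX.exists_extension hom hcl hh.1
    have hC := hom.isC1Field hH
    refine ⟨H, ⟨hH, (hres.isCompatible_iff hC hι hh.2.1).2 hh.2⟩, fun x => ?_⟩
    rw [← hres.flow_eq hC hι (by simp) (hh.2.1 (mem_univ x))]
    exact congrArg Subtype.val (hφ ⟨x, mem_univ x⟩)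

end Extension

end

theorem proposition1 {E : Type*} [NormedAddCommGroup E] [NormedSpace ℝ E] [FiniteDimensional ℝ E]
    {M : Type*} [TopologicalSpace M] [T2Space M] [SecondCountableTopology M]
    [ChartedSpace E M] [IsManifold 𝓘(ℝ, E) ∞ M]
    (om : TangentBilin E M) (hom : IsSymplecticForm om) (X : Set M) (hX : IsClosed X) :
    (∃ G : Subgroup (X ≃ₜ X), (fun (g : X ≃ₜ X) (x : X) => g x) '' (G : Set (X ≃ₜ X)) = Ham om X) ∧
    (∀ (F : Type*) [NormedAddCommGroup F] [NormedSpace ℝ F] [FiniteDimensional ℝ F]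
      [ChartedSpace F X] [IsManifold 𝓘(ℝ, F) ∞ X], IsSymplecticSubmanifold F om X →
      Ham om X = (Equiv.Set.univ X).arrowCongr (Equiv.Set.univ X) ''
        Ham (pullbackBilin (F := F) (Subtype.val : X → M) om) (univ : Set X)) :=
  ⟨exists_subgroup_image_eq_Ham hom, fun _ _ _ _ _ _ hF => hF.Ham_eq hom hX⟩
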